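/- Let $\mathbb{F}_q$ be a finite field with $q$ elements and characteristic $p>2$, and let $m,n,r$ be positive integers with $q>n$ and $3\le r\le n-m$. Let $S_1,\dots,S_m\in\mathbb{F}_q[Z_1,\dots,Z_{n-r}]$ be polynomials of degree $1$ whose homogeneous components of degree $1$ are linearly independent. Let $\Pi_1,\dots,\Pi_{n-r}$ be the first $n-r$ elementary symmetric polynomials in $Y_1,\dots,Y_n$, put $$R_j:=S_j(\Pi_1,\dots,\Pi_{n-r})\qquad(1\le j\le m),$$ and let $V\subset\mathbb{A}^n=\overline{\mathbb{F}}_q^{\,n}$ be the affine variety of common zeros of $R_1,\dots,R_m$. Then the set of points $y\in V$ at which the Jacobian matrix $(\partial R_j/\partial Y_i)_{1\le j\le m,\,1\le i\le n}(y)$ has rank less than $m$ has codimension at least $2$ in $V$. Moreover, the singular locus of $V$ has codimension at least $2$ in $V$, i.e. $V$ is regular in codimension $1$. Here a subset $W\subset V$ has codimension at least $2$ in $V$ if $\dim W+2\le\dim V$, where $\dim W$ is the largest length $d$ of a chain $V_0\subsetneq V_1\subsetneq\cdots\subsetneq V_d$ of nonempty irreducible closed subvarieties of $\mathbb{A}^n$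 contained in the Zariski closure of $W$ (and $\dim\emptyset=-\infty$). The singular locus of $V$ is the set of $x\in V$ for which the dimension of the tangent space (the common kernel of the differentials at $x$ of all polynomials in $\overline{\mathbb{F}}_q[Y_1,\dots,Y_n]$ vanishing on $V$) differs from the maximum of the dimensions of the irreducible components of $V$ containing $x$. -/

import Mathlib

namespace SymmetricVariety

open MvPolynomial

variable {K : Type*} [Field K] {n m : ℕ}

/-- A (Zariski closed) affine variety in `𝔸ⁿ = Kⁿ`: the set of common zeros of some polynomials. -/
def IsVariety (Z : Set (Fin n → K)) : Prop :=
  ∃ I : Ideal (MvPolynomial (Fin n) K), Z = zeroLocus K I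

/-- A nonempty irreducible affine variety: not the union of two proper subvarieties. -/
def IsIrreducibleVariety (Z : Set (Fin n → K)) : Prop :=
  IsVariety Z ∧ Z.Nonempty ∧
    ∀ A B : Set (Fin n → K), IsVariety A → IsVariety B → Z = A ∪ B → Z = A ∨ Z = B

/-- The Zariski closure of a subset of `𝔸ⁿ`. -/
def zariskiClosure (W : Set (Fin n → K)) : Set (Fin n → K) :=
  zeroLocus K (vanishingIdeal K W)

/-- The dimension of a subset `W` of `𝔸ⁿ`: the largest length `d` of a chain
`V₀ ⊊ V₁ ⊊ ⋯ ⊊ V_d` of nonempty irreducible varieties contained in the Zariski closure of `W`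
(which is `W` itself if `W` is a variety). It is `⊥` for the empty set. -/
noncomputable def dimension (W : Set (Fin n → K)) : WithBot ℕ∞ :=
  Order.krullDim {Z : Set (Fin n → K) // IsIrreducibleVariety Z ∧ Z ⊆ zariskiClosure W}

/-- The subset `W` of the variety `V` has codimension at least `c` in `V`,
that is, `dim V - dim W ≥ c`. -/
def CodimensionAtLeast (c : ℕ) (V W : Set (Fin n → K)) : Prop :=
  W ⊆ V ∧ dimension W + (c : WithBot ℕ∞) ≤ dimension V

/-- `C` is an irreducible component of `V`. -/
def IsComponent (V C : Set (Fin n → K)) : Prop :=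
  Maximal (fun Z : Set (Fin n → K) => IsIrreducibleVariety Z ∧ Z ⊆ V) C

/-- The dimension of `V` at `x`: the maximum of the dimensions of the irreducible components of `V`
that contain `x`. -/
noncomputable def dimensionAt (V : Set (Fin n → K)) (x : Fin n → K) : WithBot ℕ∞ :=
  sSup {d | ∃ C, IsComponent V C ∧ x ∈ C ∧ d = dimension C}

/-- The tangent space of `V` at `x`: the common kernel of the differentials at `x` of all the
polynomials in the defining ideal `I(V)` (equivalently, of a generating set of `I(V)`). -/
noncomputable def tangentSpace (V : Set (Fin n → K)) (x : Fin n → K) :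
    Submodule K (Fin n → K) :=
  ⨅ f ∈ vanishingIdeal K V,
    LinearMap.ker (Fintype.linearCombination K (fun i => eval x (pderiv i f)))

/-- The singular locus of `V`: the points where the dimension of the tangent space differs from
the dimension of `V` at that point. -/
def singularLocus (V : Set (Fin n → K)) : Set (Fin n → K) :=
  {x | x ∈ V ∧ (Module.finrank K (tangentSpace V x) : WithBot ℕ∞) ≠ dimensionAt V x}

/-- The set of common zeros in `𝔸ⁿ` of `R₁, …, R_m`. -/
def commonZeros (R : Fin m → MvPolynomial (Fin n) K) : Set (Fin n → K) :=
  {y | ∀ j, eval y (R j) = 0}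

/-- The Jacobian matrix `(∂R_j/∂Y_i)(y)`. -/
noncomputable def jacobian (R : Fin m → MvPolynomial (Fin n) K) (y : Fin n → K) :
    Matrix (Fin m) (Fin n) K :=
  Matrix.of fun j i => eval y (pderiv i (R j))

/-- The polynomials `R_j = S_j(Π₁, …, Π_{n-r})`, where `Π_k` is the `k`-th elementary symmetric
polynomial in `Y₁, …, Y_n`; the variable of `S_j` with index `k : Fin (n - r)` is `Z_{k+1}`. -/
noncomputable def symmetricSystem {F : Type*} [Field F] (K : Type*) [Field K] [Algebra F K]
    {n m r : ℕ} (S : Fin m → MvPolynomial (Fin (n - r)) F) :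
    Fin m → MvPolynomial (Fin n) K :=
  fun j => aeval (fun k : Fin (n - r) => esymm (Fin n) K ((k : ℕ) + 1)) (S j)

end SymmetricVariety

namespace SymmetricVariety

/-! ### Dimension and height in integral extensions of polynomial rings -/

section CommutativeAlgebra

open MvPolynomial

/-! The `R j` are affine-linear, with independent linear parts, in Π_1, …, Π_{n-r}. They extend by n
- m further polynomials to n elements over which the polynomial ring is integral. Going-down then
shows that every component of V has dimension n - m
(`isIntegral_and_injective_of_mem_minimalPrimes`).

If the Jacobian drops rank at y, some nonzero combination of the gradients of Π_1, …, Π_{n-r}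
vanishes at y. Since ∂Π_{k+1}/∂Y_i is a polynomial of degree k in y_i with leading coefficient ±1
and the same coefficients for all i, the y_i are all roots of one nonzero polynomial of degree less
than n - r. So coordinates coincide, and f = ∏ (X - y_s) has two double roots or a triple root
(`exists_collisions_of_rank_lt`).

On an irreducible subset of V with such coincidences, r ≥ 3 and the m equations leave n - m - 3
generators for the coefficients of f of index at least 3. The three remaining coefficients are
determined by the multiple roots α, β. Two double roots satisfy a relation that makes both integral
once γ = α - tβ is adjoined, for suitable t; a triple root is a multiple of γ. One more generator
therefore suffices, and the dimension is at most n - m - 2 (`exists_isIntegral_of_collisions`).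

Where the rank is m the tangent space has dimension at most n - m, and at least n - m by Krull's
height theorem; so singular points are rank-deficient (`singularLocus_subset`). -/

theorem height_of_isMaximal_mvPolynomial {k ι : Type*} [Field k] [Finite ι]
    (M : Ideal (MvPolynomial ι k)) [hM : M.IsMaximal] : M.height = Nat.card ι := by
  induction ι using Finite.induction_empty_option with
  | of_equiv e ih =>
    have h : (M.comap (renameEquiv k e).toRingEquiv).IsMaximal :=
      Ideal.comap_isMaximal_of_equiv (renameEquiv k e).toRingEquiv
    have := ih (M.comap (renameEquiv k e).toRingEquiv)
    rw [RingEquiv.height_comap] at this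
    rw [this, Nat.card_congr e]
  | h_empty =>
    have h0 : IsField (MvPolynomial PEmpty k) :=
      (isEmptyRingEquiv k PEmpty).toMulEquiv.isField (Field.toIsField k)
    let := h0.toField
    have : M = ⊥ := Ideal.eq_bot_of_prime M
    subst this
    simp
  | @h_option α _ ih =>
    let e := (optionEquivLeft k α).toRingEquiv
    let M' : Ideal (Polynomial (MvPolynomial α k)) := M.comap e.symm
    have hM' : M'.IsMaximal := Ideal.comap_isMaximal_of_equiv e.symm
    -- The coefficient ring is Jacobson, so a maximal ideal contracts to a maximal ideal and the
    -- induction hypothesis applies.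
    have hp : (M'.under (MvPolynomial α k)).IsMaximal :=
      Polynomial.isMaximal_comap_C_of_isJacobsonRing M'
    have hlie : M'.LiesOver (M'.under (MvPolynomial α k)) := ⟨rfl⟩
    have h1 := Polynomial.height_eq_height_add_one (M'.under (MvPolynomial α k)) M'
    have h2 : M'.height = M.height := RingEquiv.height_comap e.symm M
    rw [← h2, h1, ih]
    simp

theorem ringKrullDim_le_of_isIntegral {A B : Type*} [CommRing A] [CommRing B] (f : A →+* B)
    (hf : f.IsIntegral) : ringKrullDim B ≤ ringKrullDim A := by
  algebraize [f]
  refine Order.krullDim_le_of_strictMono (PrimeSpectrum.comap (algebraMap A B)) ?_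
  intro p q hpq
  exact Ideal.IsIntegral.comap_lt_comap hpq

/-- Going-down holds over the normal domain of polynomials, so the height of `M` is at least that of
its contraction, which is maximal. -/
theorem card_le_height_of_isIntegral {k ι B : Type*} [Field k] [Finite ι] [CommRing B] [IsDomain B]
    [IsNoetherianRing B] (f : MvPolynomial ι k →+* B) (hf : f.IsIntegral)
    (hinj : Function.Injective f) (M : Ideal B) [M.IsMaximal] : (Nat.card ι : ℕ∞) ≤ M.height := by
  algebraize [f]
  have : FaithfulSMul (MvPolynomial ι k) B :=
    (faithfulSMul_iff_algebraMap_injective _ _).2 hinj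
  have hmax : (M.under (MvPolynomial ι k)).IsMaximal := inferInstance
  have h := Ideal.height_eq_height_add_of_liesOver_of_hasGoingDown
    (M.under (MvPolynomial ι k)) M
  rw [h, height_of_isMaximal_mvPolynomial]
  exact le_self_add

theorem ringKrullDim_mvPolynomial_field {k ι : Type*} [Field k] [Finite ι] :
    ringKrullDim (MvPolynomial ι k) = Nat.card ι := by
  simp

theorem ringKrullDim_eq_of_isIntegral {k ι B : Type*} [Field k] [Finite ι] [CommRing B] [IsDomain B]
    [IsNoetherianRing B] (f : MvPolynomial ι k →+* B) (hf : f.IsIntegral)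
    (hinj : Function.Injective f) : ringKrullDim B = Nat.card ι := by
  apply le_antisymm
  · exact (ringKrullDim_le_of_isIntegral f hf).trans ringKrullDim_mvPolynomial_field.le
  · obtain ⟨M, hM⟩ := Ideal.exists_maximal B
    calc ((Nat.card ι : ℕ) : WithBot ℕ∞) = ((Nat.card ι : ℕ∞) : WithBot ℕ∞) := rfl
      _ ≤ (M.height : WithBot ℕ∞) := WithBot.coe_le_coe.2 (card_le_height_of_isIntegral f hf hinj M)
      _ ≤ _ := Ideal.height_le_ringKrullDim_of_ne_top hM.ne_top

/-- A nonzero g in the kernel would make `B` integral over the polynomials modulo g, a ring of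
smaller dimension. -/
theorem injective_of_isIntegral_of_card_le {k ι B : Type*} [Field k] [Finite ι] [CommRing B]
    [IsDomain B] (f : MvPolynomial ι k →+* B) (hf : f.IsIntegral)
    (h : (Nat.card ι : WithBot ℕ∞) ≤ ringKrullDim B) : Function.Injective f := by
  rw [RingHom.injective_iff_ker_eq_bot]
  by_contra hker
  obtain ⟨g, hg, hg0⟩ := Submodule.exists_mem_ne_zero_of_ne_bot hker
  have hgf : ∀ a ∈ Ideal.span {g}, f a = 0 := fun a ha =>
    (RingHom.mem_ker).1 ((Ideal.span_singleton_le_iff_mem _).2 hg ha)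
  have hint : (Ideal.Quotient.lift (Ideal.span {g}) f hgf).IsIntegral := by
    refine RingHom.IsIntegral.tower_top (Ideal.Quotient.mk (Ideal.span {g})) _ ?_
    rw [Ideal.Quotient.lift_comp_mk]
    exact hf
  have h1 := ringKrullDim_le_of_isIntegral _ hint
  have h2 := ringKrullDim_quotient_succ_le_of_nonZeroDivisor (mem_nonZeroDivisors_of_ne_zero hg0)
  rw [ringKrullDim_mvPolynomial_field] at h2
  have h3 : (Nat.card ι : WithBot ℕ∞) + 1 ≤ Nat.card ι := le_trans (by gcongr; exact h.trans h1) h2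
  have h4 : Nat.card ι + 1 ≤ Nat.card ι := by exact_mod_cast h3
  omega

/-- If `M ⊆ (s) + M²` for a maximal ideal `M` containing `s`, then the height of `M` is at most
the number of elements of `s`. -/
theorem height_le_ncard_of_le_span_sup_sq {B : Type*} [CommRing B] [IsNoetherianRing B]
    (M : Ideal B) [hM : M.IsMaximal] (s : Set B) (hs : s.Finite) (hsM : s ⊆ M)
    (h : M ≤ Ideal.span s ⊔ M ^ 2) : M.height ≤ s.ncard := by
  apply Ideal.height_le_card_of_mem_minimalPrimes_span hs
  refine ⟨⟨hM.isPrime, Ideal.span_le.2 hsM⟩, ?_⟩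
  rintro Q ⟨hQ, hsQ⟩ hQM
  -- Nakayama: some r ≡ 1 mod `M` carries `M` into (s). As r lies outside every prime below `M`, a
  -- prime between (s) and `M` is `M`.
  obtain ⟨r, hr, hrM⟩ := Submodule.exists_sub_one_mem_and_smul_le_of_fg_of_le_sup
    (I := M) (N' := M) (N := Ideal.span s) (P := M) (IsNoetherian.noetherian M) le_rfl (by
      simpa [pow_two] using h)
  intro x hx
  have hrx : r * x ∈ Q := hsQ (hrM (Submodule.smul_mem_pointwise_smul x r M hx))
  refine (hQ.mem_or_mem hrx).resolve_left fun hrQ => hM.ne_top ?_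
  rw [Ideal.eq_top_iff_one]
  simpa using M.sub_mem (hQM hrQ) hr

end CommutativeAlgebra

/-! ### Nullstellensatz: varieties and prime ideals -/

section Dictionary

open MvPolynomial

variable {K : Type*} [Field K] {n m : ℕ}

theorem zariskiClosure_eq_self {Z : Set (Fin n → K)} (hZ : IsVariety Z) : zariskiClosure Z = Z := by
  obtain ⟨I, rfl⟩ := hZ
  exact Set.Subset.antisymm (zeroLocus_anti_mono (le_vanishingIdeal_zeroLocus I))
    (zeroLocus_vanishingIdeal_le _)

theorem isVariety_zeroLocus (I : Ideal (MvPolynomial (Fin n) K)) : IsVariety (zeroLocus K I) :=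
  ⟨I, rfl⟩

theorem zeroLocus_sup (I J : Ideal (MvPolynomial (Fin n) K)) :
    zeroLocus K (I ⊔ J) = zeroLocus K I ∩ zeroLocus K J := by
  ext x
  constructor
  · intro h
    exact ⟨fun p hp => h p (Ideal.mem_sup_left hp), fun p hp => h p (Ideal.mem_sup_right hp)⟩
  · rintro ⟨h1, h2⟩ p hp
    obtain ⟨a, ha, b, hb, rfl⟩ := Submodule.mem_sup.1 hp
    rw [map_add, h1 a ha, h2 b hb, add_zero]

theorem IsIrreducibleVariety.isPrime_vanishingIdeal {Z : Set (Fin n → K)}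
    (hZ : IsIrreducibleVariety Z) : (vanishingIdeal K Z).IsPrime := by
  obtain ⟨hV, ⟨x, hx⟩, hirr⟩ := hZ
  refine ⟨fun h => ?_, fun {f g} hfg => ?_⟩
  · have h1 : (1 : MvPolynomial (Fin n) K) ∈ vanishingIdeal K Z := h ▸ Submodule.mem_top
    simpa using h1 x hx
  · have key : ∀ f : MvPolynomial (Fin n) K, Z = Z ∩ zeroLocus K (Ideal.span {f}) →
        f ∈ vanishingIdeal K Z := fun f hf x hx => by
      rw [hf] at hx
      exact hx.2 f (Ideal.mem_span_singleton_self f)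
    have hvar : ∀ f : MvPolynomial (Fin n) K, IsVariety (Z ∩ zeroLocus K (Ideal.span {f})) := by
      intro f
      obtain ⟨I, rfl⟩ := hV
      rw [← zeroLocus_sup]
      exact isVariety_zeroLocus _
    refine (hirr _ _ (hvar f) (hvar g) ?_).imp (key f) (key g)
    ext y
    refine ⟨fun hy => ?_, fun hy => hy.elim (fun h => h.1) (fun h => h.1)⟩
    have hy' := hfg y hy
    rw [map_mul, mul_eq_zero] at hy'
    refine hy'.imp (fun h => ⟨hy, ?_⟩) (fun h => ⟨hy, ?_⟩) <;>
    · rw [zeroLocus_span]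
      simpa using h

theorem isIrreducibleVariety_zeroLocus [IsAlgClosed K] (P : Ideal (MvPolynomial (Fin n) K))
    [hP : P.IsPrime] : IsIrreducibleVariety (zeroLocus K P) := by
  refine ⟨isVariety_zeroLocus P, ?_, ?_⟩
  · by_contra hne
    rw [Set.not_nonempty_iff_eq_empty] at hne
    have h := IsPrime.vanishingIdeal_zeroLocus (K := K) P
    rw [hne, vanishingIdeal_empty] at h
    exact hP.ne_top h.symm
  · rintro A B hA hB hAB
    have hle : vanishingIdeal K A * vanishingIdeal K B ≤ P := by
      rw [← IsPrime.vanishingIdeal_zeroLocus (K := K) P, hAB, Ideal.mul_le]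
      intro f hf g hg x hx
      rw [map_mul, mul_eq_zero]
      exact hx.imp (hf x) (hg x)
    have hsub : ∀ A : Set (Fin n → K), IsVariety A → A ⊆ zeroLocus K P →
        vanishingIdeal K A ≤ P → zeroLocus K P = A := by
      intro A hA hAP h
      refine Set.Subset.antisymm ?_ hAP
      calc zeroLocus K P ⊆ zeroLocus K (vanishingIdeal K A) := zeroLocus_anti_mono h
        _ = A := zariskiClosure_eq_self hA
    exact (hP.mul_le.1 hle).imp (hsub A hA (hAB ▸ Set.subset_union_left))
      (hsub B hB (hAB ▸ Set.subset_union_right))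

theorem subset_zariskiClosure_iff {Z W : Set (Fin n → K)} :
    Z ⊆ zariskiClosure W ↔ vanishingIdeal K W ≤ vanishingIdeal K Z :=
  le_zeroLocus_iff_le_vanishingIdeal

/-- The correspondence of the Nullstellensatz between the irreducible varieties contained in the
closure of `W` and the prime ideals containing the ideal of `W`. -/
noncomputable def irreducibleVarietyOrderIso [IsAlgClosed K] (W : Set (Fin n → K)) :
    {Z : Set (Fin n → K) // IsIrreducibleVariety Z ∧ Z ⊆ zariskiClosure W} ≃o
      (PrimeSpectrum.zeroLocus (vanishingIdeal K W : Set (MvPolynomial (Fin n) K)))ᵒᵈ where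
  toFun Z := OrderDual.toDual ⟨⟨vanishingIdeal K Z.1, Z.2.1.isPrime_vanishingIdeal⟩,
    subset_zariskiClosure_iff.1 Z.2.2⟩
  invFun p := ⟨zeroLocus K (OrderDual.ofDual p).1.asIdeal,
    have := (OrderDual.ofDual p).1.isPrime
    ⟨isIrreducibleVariety_zeroLocus _, subset_zariskiClosure_iff.2 (by
      rw [IsPrime.vanishingIdeal_zeroLocus]
      exact (OrderDual.ofDual p).2)⟩⟩
  left_inv Z := Subtype.ext (zariskiClosure_eq_self Z.2.1.1)
  right_inv p := by
    have := (OrderDual.ofDual p).1.isPrime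
    apply OrderDual.ofDual.injective
    apply Subtype.ext
    apply PrimeSpectrum.ext
    exact IsPrime.vanishingIdeal_zeroLocus _
  map_rel_iff' {Z Y} := by
    change vanishingIdeal K Y.1 ≤ vanishingIdeal K Z.1 ↔ Z.1 ⊆ Y.1
    rw [← subset_zariskiClosure_iff, zariskiClosure_eq_self Y.2.1.1]

theorem dimension_eq_ringKrullDim [IsAlgClosed K] (W : Set (Fin n → K)) :
    dimension W = ringKrullDim (MvPolynomial (Fin n) K ⧸ vanishingIdeal K W) := by
  rw [dimension, Order.krullDim_eq_of_orderIso (irreducibleVarietyOrderIso W),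
    Order.krullDim_orderDual, ringKrullDim_quotient]

theorem dimension_mono [IsAlgClosed K] {W W' : Set (Fin n → K)} (h : W ⊆ W') :
    dimension W ≤ dimension W' := by
  rw [dimension_eq_ringKrullDim, dimension_eq_ringKrullDim]
  exact ringKrullDim_le_of_surjective (Ideal.Quotient.factor (vanishingIdeal_anti_mono h))
    (Ideal.Quotient.factor_surjective _)

/-- A chain of primes lies above its smallest member, so its length is bounded in the quotient by
that prime. -/
theorem dimension_le_of_forall_prime [IsAlgClosed K] (W : Set (Fin n → K)) (d : ℕ)
    (h : ∀ P : Ideal (MvPolynomial (Fin n) K), P.IsPrime → vanishingIdeal K W ≤ P →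
      ringKrullDim (MvPolynomial (Fin n) K ⧸ P) ≤ d) : dimension W ≤ d := by
  rw [dimension_eq_ringKrullDim, ringKrullDim_quotient]
  refine iSup_le fun l => ?_
  have hP := l.head.1.isPrime
  refine le_trans ?_ (h l.head.1.asIdeal hP l.head.2)
  rw [ringKrullDim_quotient]
  let l' : LTSeries (PrimeSpectrum.zeroLocus (l.head.1.asIdeal : Set (MvPolynomial (Fin n) K))) :=
    { length := l.length
      toFun := fun i => ⟨(l i).1, l.head_le i⟩
      step := fun i => l.step i }
  exact Order.LTSeries.length_le_krullDim l'

theorem IsComponent.vanishingIdeal_mem_minimalPrimes [IsAlgClosed K] {V C : Set (Fin n → K)}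
    (hV : IsVariety V) (hC : IsComponent V C) :
    vanishingIdeal K C ∈ (vanishingIdeal K V).minimalPrimes := by
  have hp := hC.prop.1.isPrime_vanishingIdeal
  refine ⟨⟨hp, vanishingIdeal_anti_mono hC.prop.2⟩, ?_⟩
  rintro Q ⟨hQ, hVQ⟩ hQC
  have h1 : C ⊆ zeroLocus K Q := le_zeroLocus_iff_le_vanishingIdeal.2 hQC
  have h2 : zeroLocus K Q ⊆ V := by
    conv_rhs => rw [← zariskiClosure_eq_self hV]
    exact zeroLocus_anti_mono hVQ
  have h3 : zeroLocus K Q ⊆ C := hC.le_of_ge ⟨isIrreducibleVariety_zeroLocus Q, h2⟩ h1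
  have h4 := vanishingIdeal_anti_mono (k := K) h3
  rwa [IsPrime.vanishingIdeal_zeroLocus] at h4

theorem isComponent_zeroLocus [IsAlgClosed K] {V : Set (Fin n → K)} (hV : IsVariety V)
    {P : Ideal (MvPolynomial (Fin n) K)} (hP : P ∈ (vanishingIdeal K V).minimalPrimes) :
    IsComponent V (zeroLocus K P) := by
  have hp : P.IsPrime := hP.1.1
  refine ⟨⟨isIrreducibleVariety_zeroLocus P, ?_⟩, ?_⟩
  · conv_rhs => rw [← zariskiClosure_eq_self hV]
    exact zeroLocus_anti_mono hP.1.2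
  · rintro Z ⟨hZ, hZV⟩ hPZ
    have h1 := vanishingIdeal_anti_mono (k := K) hPZ
    rw [IsPrime.vanishingIdeal_zeroLocus] at h1
    have h2 := hP.2 ⟨hZ.isPrime_vanishingIdeal, vanishingIdeal_anti_mono hZV⟩ h1
    exact le_zeroLocus_iff_le_vanishingIdeal.2 h2

theorem dimensionAt_eq [IsAlgClosed K] {V : Set (Fin n → K)} (hV : IsVariety V) (d : ℕ)
    (h : ∀ P ∈ (vanishingIdeal K V).minimalPrimes,
      ringKrullDim (MvPolynomial (Fin n) K ⧸ P) = d) {x : Fin n → K} (hx : x ∈ V) :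
    dimensionAt V x = d := by
  have hset : {e | ∃ C, IsComponent V C ∧ x ∈ C ∧ e = dimension C} = {(d : WithBot ℕ∞)} := by
    ext e
    constructor
    · rintro ⟨C, hC, -, rfl⟩
      rw [Set.mem_singleton_iff, dimension_eq_ringKrullDim,
        h _ (hC.vanishingIdeal_mem_minimalPrimes hV)]
    · rintro rfl
      obtain ⟨P, hP, hPx⟩ := Ideal.exists_minimalPrimes_le (J := vanishingIdeal K {x})
        (vanishingIdeal_anti_mono (k := K) (Set.singleton_subset_iff.2 hx))
      have hp : P.IsPrime := hP.1.1
      refine ⟨_, isComponent_zeroLocus hV hP, fun p hp => ?_, ?_⟩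
      · exact hPx hp x rfl
      · rw [dimension_eq_ringKrullDim, IsPrime.vanishingIdeal_zeroLocus, h P hP]
  rw [dimensionAt, hset, sSup_singleton]

end Dictionary

/-! ### Tangent spaces and the Jacobian -/

section Tangent

open MvPolynomial

variable {K : Type*} [Field K] {n m : ℕ}

/-- The gradient at a point, as a linear map. -/
noncomputable def gradient (y : Fin n → K) : MvPolynomial (Fin n) K →ₗ[K] (Fin n → K) :=
  LinearMap.pi fun i => (aeval y : MvPolynomial (Fin n) K →ₐ[K] K).toLinearMap ∘ₗ
    (pderiv i : Derivation K (MvPolynomial (Fin n) K) (MvPolynomial (Fin n) K)).toLinearMap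

theorem gradient_apply (y : Fin n → K) (f : MvPolynomial (Fin n) K) (i : Fin n) :
    gradient y f i = eval y (pderiv i f) := by
  simp [gradient, aeval_eq_eval]

/-- The linear form with the given coefficients, centred at `y`. -/
noncomputable def centredForm (y : Fin n → K) : (Fin n → K) →ₗ[K] MvPolynomial (Fin n) K :=
  Fintype.linearCombination K fun i => X i - C (y i)

theorem centredForm_apply (y v : Fin n → K) :
    centredForm y v = ∑ i, C (v i) * (X i - C (y i)) := by
  simp [centredForm, Fintype.linearCombination_apply, smul_eq_C_mul]

theorem X_sub_C_mem (y : Fin n → K) (i : Fin n) :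
    X i - C (y i) ∈ vanishingIdeal K {y} := by
  simp

theorem centredForm_mem (y v : Fin n → K) : centredForm y v ∈ vanishingIdeal K {y} := by
  simp [centredForm_apply]

/-- First-order Taylor expansion at `y`. -/
theorem sub_centredForm_gradient_mem_sq (y : Fin n → K) (g : MvPolynomial (Fin n) K) :
    g - C (eval y g) - centredForm y (gradient y g) ∈
      (vanishingIdeal K {y} : Ideal (MvPolynomial (Fin n) K)) ^ 2 := by
  induction g using MvPolynomial.induction_on with
  | C a =>
    have : gradient y (C a) = 0 := by
      ext i
      simp [gradient_apply]
    simp [this]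
  | add p q hp hq =>
    convert add_mem hp hq using 1
    simp only [map_add]
    ring
  | mul_X p j hp =>
    have hgrad : gradient y (p * X j) = y j • gradient y p + eval y p • Pi.single j 1 := by
      ext i
      simp only [gradient_apply, Derivation.leibniz, Pi.add_apply, Pi.smul_apply, smul_eq_mul,
        map_add, map_mul, eval_X, pderiv_X]
      rw [Pi.single_comm]
      by_cases h : i = j
      · subst h
        simp
        ring
      · simp [h]
    have hsingle : centredForm y (Pi.single j 1) = X j - C (y j) := by
      simp [centredForm]
    have h1 : p - C (eval y p) ∈ (vanishingIdeal K {y} : Ideal (MvPolynomial (Fin n) K)) := by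
      simp [aeval_eq_eval]
    have h2 := Ideal.mul_mem_mul h1 (X_sub_C_mem y j)
    rw [← pow_two] at h2
    convert add_mem (Ideal.mul_mem_right (C (y j)) _ hp) h2 using 1
    rw [hgrad, map_add, map_smul, map_smul, hsingle, smul_eq_C_mul, smul_eq_C_mul, map_mul, eval_X,
      map_mul]
    ring

/-- The tangent space is the orthogonal complement, for the dot product, of the gradients of I(V).
-/
theorem finrank_tangentSpace (V : Set (Fin n → K)) (y : Fin n → K) :
    Module.finrank K (((vanishingIdeal K V).restrictScalars K).map (gradient y)) +
      Module.finrank K (tangentSpace V y) = n := by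
  set D := ((vanishingIdeal K V).restrictScalars K).map (gradient y)
  let e := (dotProductEquiv K (Fin n)).toLinearMap
  have he : Function.Injective e := (dotProductEquiv K (Fin n)).injective
  have h1 : tangentSpace V y = (D.map e).dualCoannihilator := by
    ext v
    simp only [tangentSpace, Submodule.mem_iInf, LinearMap.mem_ker, Submodule.mem_dualCoannihilator,
      Fintype.linearCombination_apply]
    constructor
    · rintro h _ ⟨_, ⟨f, hf, rfl⟩, rfl⟩
      have := h f hf
      simpa [e, dotProduct, gradient_apply, mul_comm] using this
    · intro h f hf
      have := h _ ⟨_, ⟨f, hf, rfl⟩, rfl⟩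
      simpa [e, dotProduct, gradient_apply, mul_comm] using this
  have h2 : Module.finrank K (D.map e) = Module.finrank K D :=
    LinearEquiv.finrank_map_eq (dotProductEquiv K (Fin n)) D
  rw [h1, ← h2, Subspace.finrank_add_finrank_dualCoannihilator_eq, Module.finrank_fin_fun]

/-- Krull's height theorem bounds the local dimension by the dimension of the tangent space. -/
theorem height_le_finrank_tangentSpace (V : Set (Fin n → K)) (y : Fin n → K)
    (P : Ideal (MvPolynomial (Fin n) K)) (hVP : vanishingIdeal K V ≤ P)
    (hPy : P ≤ vanishingIdeal K {y})
    (hM : ((vanishingIdeal K {y}).map (Ideal.Quotient.mk P)).IsMaximal) :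
    ((vanishingIdeal K {y}).map (Ideal.Quotient.mk P)).height ≤
      Module.finrank K (tangentSpace V y) := by
  set D := ((vanishingIdeal K V).restrictScalars K).map (gradient y) with hD
  -- Gradients in `D` come from elements of I(V), which vanish modulo `P`; hence the centred forms
  -- of a basis of `D'` generate the maximal ideal modulo its square.
  obtain ⟨D', hD'⟩ := exists_isCompl D
  have hfin : Module.finrank K D' = Module.finrank K (tangentSpace V y) := by
    have h1 := finrank_tangentSpace V y
    have h2 := Submodule.finrank_add_eq_of_isCompl hD'
    rw [Module.finrank_fin_fun] at h2
    rw [← hD] at h1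
    omega
  let b := Module.finBasis K D'
  let s : Set (MvPolynomial (Fin n) K ⧸ P) :=
    Set.range fun i => Ideal.Quotient.mk P (centredForm y (b i))
  have hs : s.Finite := Set.finite_range _
  have hcard : s.ncard ≤ Module.finrank K D' := by
    have := Set.ncard_image_le (f := fun i => Ideal.Quotient.mk P (centredForm y (b i)))
      (Set.finite_univ (α := Fin (Module.finrank K D')))
    simpa [Set.image_univ, Set.ncard_univ] using this
  have hspan : ∀ v ∈ D', Ideal.Quotient.mk P (centredForm y v) ∈ Ideal.span s := by
    intro v hv
    have hsum := b.sum_repr ⟨v, hv⟩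
    have hv' : v = ∑ i, b.repr ⟨v, hv⟩ i • (b i : Fin n → K) := by
      conv_lhs => rw [show v = ((⟨v, hv⟩ : D') : Fin n → K) from rfl, ← hsum]
      simp only [Submodule.coe_sum, Submodule.coe_smul]
    rw [hv', map_sum, map_sum]
    refine Ideal.sum_mem _ fun i _ => ?_
    rw [map_smul, smul_eq_C_mul, map_mul]
    exact Ideal.mul_mem_left _ _ (Ideal.subset_span ⟨i, rfl⟩)
  rw [← hfin]
  refine le_trans (height_le_ncard_of_le_span_sup_sq _ s hs ?_ ?_) (by exact_mod_cast hcard)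
  · rintro _ ⟨i, rfl⟩
    exact Ideal.mem_map_of_mem _ (centredForm_mem y _)
  · intro g' hg'
    obtain ⟨g, hg, rfl⟩ := (Ideal.mem_map_iff_of_surjective _ Ideal.Quotient.mk_surjective).1 hg'
    have htop : gradient y g ∈ D ⊔ D' := by
      rw [hD'.sup_eq_top]
      exact Submodule.mem_top
    obtain ⟨_, ⟨f, hf, rfl⟩, v, hv, hgv⟩ := Submodule.mem_sup.1 htop
    have hfP : Ideal.Quotient.mk P f = 0 := Ideal.Quotient.eq_zero_iff_mem.2 (hVP hf)
    have h0 : eval y (g - f) = 0 := by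
      have h1 : aeval y g = 0 := hg y rfl
      have h2 : aeval y f = 0 := hPy (hVP hf) y rfl
      rw [aeval_eq_eval] at h1 h2
      simpa [h2] using h1
    have hgrad : gradient y (g - f) = v := by
      rw [map_sub, ← hgv, add_sub_cancel_left]
    have ht := sub_centredForm_gradient_mem_sq y (g - f)
    rw [h0, hgrad, map_zero, sub_zero] at ht
    have ht' := Ideal.mem_map_of_mem (Ideal.Quotient.mk P) ht
    rw [Ideal.map_pow, map_sub, map_sub, hfP, sub_zero] at ht'
    rw [← sub_add_cancel (Ideal.Quotient.mk P g) (Ideal.Quotient.mk P (centredForm y v)), add_comm]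
    exact Submodule.add_mem_sup (hspan v hv) ht'

theorem finrank_tangentSpace_le (R : Fin m → MvPolynomial (Fin n) K) (y : Fin n → K)
    (hrank : (jacobian R y).rank = m) :
    Module.finrank K (tangentSpace (commonZeros R) y) ≤ n - m := by
  have hle : tangentSpace (commonZeros R) y ≤ LinearMap.ker (jacobian R y).mulVecLin := by
    intro v hv
    rw [LinearMap.mem_ker]
    ext j
    simp only [tangentSpace, Submodule.mem_iInf, LinearMap.mem_ker,
      Fintype.linearCombination_apply] at hv
    have := hv (R j) (fun x hx => by rw [aeval_eq_eval]; exact hx j)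
    simpa [jacobian, Matrix.mulVec, dotProduct, mul_comm] using this
  have h1 := Submodule.finrank_mono hle
  have h2 := LinearMap.finrank_range_add_finrank_ker (jacobian R y).mulVecLin
  rw [Module.finrank_fin_fun] at h2
  rw [Matrix.rank] at hrank
  omega

end Tangent

/-! ### Polynomials with two double roots or a triple root -/

section DoubleRoots

open Polynomial

variable {K B : Type*} [Field K] [CommRing B] [Algebra K B]

theorem mem_lifts_of_coeff_mem {A : Subalgebra K B} {p : B[X]} (hp : ∀ j, p.coeff j ∈ A) :
    p ∈ lifts (algebraMap A B) := by
  rw [lifts_iff_coeff_lifts]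
  exact fun j => ⟨⟨_, hp j⟩, rfl⟩

theorem eval_mem_of_coeff_mem {A : Subalgebra K B} {p : B[X]} (hp : ∀ j, p.coeff j ∈ A) {x : B}
    (hx : x ∈ A) : p.eval x ∈ A := by
  rw [eval_eq_sum_range]
  exact sum_mem fun j _ => mul_mem (hp j) (pow_mem hx j)

theorem coeff_derivative_mem {A : Subalgebra K B} {p : B[X]} (hp : ∀ j, p.coeff j ∈ A) (j : ℕ) :
    (derivative p).coeff j ∈ A := by
  rw [coeff_derivative]
  exact mul_mem (hp _) (by exact_mod_cast natCast_mem A (j + 1))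

theorem exists_mem_eval_sub_eval {A : Subalgebra K B} {p : B[X]} (hp : ∀ j, p.coeff j ∈ A) {x y : B}
    (hx : x ∈ A) (hy : y ∈ A) : ∃ q ∈ A, p.eval x - p.eval y = (x - y) * q := by
  obtain ⟨p₀, rfl⟩ := mem_lifts_of_coeff_mem hp
  obtain ⟨q, hq⟩ := sub_dvd_eval_sub (⟨x, hx⟩ : A) ⟨y, hy⟩ p₀
  refine ⟨q, q.2, ?_⟩
  have h := congrArg (algebraMap A B) hq
  rw [map_sub, map_mul, map_sub, ← eval_map_apply, ← eval_map_apply] at h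
  exact h

theorem mem_of_two_mul_mem (h2 : (2 : K) ≠ 0) {A : Subalgebra K B} {a : B} (h : 2 * a ∈ A) :
    a ∈ A := by
  have : a = (2⁻¹ : K) • (2 * a) := by
    rw [Algebra.smul_def, ← mul_assoc, ← map_ofNat (algebraMap K B) 2, ← map_mul,
      inv_mul_cancel₀ h2, map_one, one_mul]
  rw [this]
  exact A.smul_mem h _

/-- A polynomial without its quadratic part. -/
noncomputable def dropQuadratic (f : B[X]) : B[X] :=
  f - (C (f.coeff 2) * X ^ 2 + C (f.coeff 1) * X + C (f.coeff 0))

theorem dropQuadratic_add (f : B[X]) :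
    f = dropQuadratic f + (C (f.coeff 2) * X ^ 2 + C (f.coeff 1) * X + C (f.coeff 0)) := by
  simp [dropQuadratic]

theorem coeff_dropQuadratic_of_le (f : B[X]) {j : ℕ} (hj : 3 ≤ j) :
    (dropQuadratic f).coeff j = f.coeff j := by
  obtain ⟨k, rfl⟩ := Nat.exists_eq_add_of_le' hj
  simp [dropQuadratic]

theorem coeff_dropQuadratic_of_lt (f : B[X]) {j : ℕ} (hj : j < 3) :
    (dropQuadratic f).coeff j = 0 := by
  interval_cases j <;> simp [dropQuadratic, coeff_X, coeff_C, coeff_X_pow]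

theorem coeff_dropQuadratic_mem {A : Subalgebra K B} {f : B[X]} (hf : ∀ j, 3 ≤ j → f.coeff j ∈ A)
    (j : ℕ) : (dropQuadratic f).coeff j ∈ A := by
  by_cases hj : 3 ≤ j
  · rw [coeff_dropQuadratic_of_le f hj]
    exact hf j hj
  · rw [coeff_dropQuadratic_of_lt f (not_le.1 hj)]
    exact zero_mem A

theorem eval_eq_dropQuadratic (f : B[X]) (x : B) :
    f.eval x = (dropQuadratic f).eval x + f.coeff 2 * x ^ 2 + f.coeff 1 * x + f.coeff 0 := by
  conv_lhs => rw [dropQuadratic_add f]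
  simp
  ring

theorem eval_derivative_eq_dropQuadratic (f : B[X]) (x : B) :
    (derivative f).eval x =
      (derivative (dropQuadratic f)).eval x + 2 * f.coeff 2 * x + f.coeff 1 := by
  conv_lhs => rw [dropQuadratic_add f]
  simp
  ring

theorem eval_derivative_derivative_eq_dropQuadratic (f : B[X]) (x : B) :
    (derivative (derivative f)).eval x =
      (derivative (derivative (dropQuadratic f))).eval x + 2 * f.coeff 2 := by
  conv_lhs => rw [dropQuadratic_add f]
  simp
  ring

/-- The system is triangular: f'(α) = 0 yields the linear coefficient, then f(α) = 0 the constant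
one. -/
theorem coeff_mem_of_coeff_two_mem {A : Subalgebra K B} {f : B[X]}
    (hf : ∀ j, 3 ≤ j → f.coeff j ∈ A) {α : B} (hα : α ∈ A) (h0 : f.eval α = 0)
    (h1 : (derivative f).eval α = 0) (h2 : 2 * f.coeff 2 ∈ A) (h2' : f.coeff 2 ∈ A) (j : ℕ) :
    f.coeff j ∈ A := by
  have hg := coeff_dropQuadratic_mem hf
  rw [eval_eq_dropQuadratic] at h0
  rw [eval_derivative_eq_dropQuadratic] at h1
  have hb : f.coeff 1 ∈ A := by
    rw [eq_neg_of_add_eq_zero_right h1]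
    exact neg_mem (add_mem (eval_mem_of_coeff_mem (coeff_derivative_mem hg) hα) (mul_mem h2 hα))
  have hc : f.coeff 0 ∈ A := by
    rw [eq_neg_of_add_eq_zero_right h0]
    exact neg_mem (add_mem (add_mem (eval_mem_of_coeff_mem hg hα) (mul_mem h2' (pow_mem hα 2)))
      (mul_mem hb hα))
  match j with
  | 0 => exact hc
  | 1 => exact hb
  | 2 => exact h2'
  | j + 3 => exact hf _ (by omega)

theorem coeff_mem_of_triple_root (h2 : (2 : K) ≠ 0) {A : Subalgebra K B} {f : B[X]}
    (hf : ∀ j, 3 ≤ j → f.coeff j ∈ A) {α : B} (hα : α ∈ A) (hdvd : (X - C α) ^ 3 ∣ f) (j : ℕ) :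
    f.coeff j ∈ A := by
  have hg := coeff_dropQuadratic_mem hf
  obtain ⟨h, hh⟩ := hdvd
  have e0 : f.eval α = 0 := by simp [hh]
  have e1 : (derivative f).eval α = 0 := by simp [hh, derivative_pow]
  have e2 : (derivative (derivative f)).eval α = 0 := by simp [hh, derivative_pow]
  have ha : 2 * f.coeff 2 ∈ A := by
    rw [eval_derivative_derivative_eq_dropQuadratic] at e2
    rw [eq_neg_of_add_eq_zero_right e2]
    exact neg_mem (eval_mem_of_coeff_mem (coeff_derivative_mem (coeff_derivative_mem hg)) hα)
  exact coeff_mem_of_coeff_two_mem hf hα e0 e1 ha (mem_of_two_mul_mem h2 ha) j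

/-- Subtracting f'(β) = 0 from f'(α) = 0 and cancelling α - β expresses twice the quadratic
coefficient as a divided difference over `A`. -/
theorem coeff_mem_of_double_roots [IsDomain B] (h2 : (2 : K) ≠ 0) {A : Subalgebra K B} {f : B[X]}
    (hf : ∀ j, 3 ≤ j → f.coeff j ∈ A) {α β : B} (hα : α ∈ A) (hβ : β ∈ A) (hαβ : α ≠ β)
    (e0 : f.eval α = 0) (e1 : (derivative f).eval α = 0) (e1' : (derivative f).eval β = 0) (j : ℕ) :
    f.coeff j ∈ A := by
  have hg := coeff_dropQuadratic_mem hf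
  have ha : 2 * f.coeff 2 ∈ A := by
    obtain ⟨q, hq, hqe⟩ := exists_mem_eval_sub_eval (coeff_derivative_mem hg) hα hβ
    have e3 := e1
    rw [eval_derivative_eq_dropQuadratic] at e1' e3
    have : (α - β) * (q + 2 * f.coeff 2) = 0 := by linear_combination e3 - e1' - hqe
    have := (mul_eq_zero.1 this).resolve_left (sub_ne_zero.2 hαβ)
    rw [eq_neg_of_add_eq_zero_right this]
    exact neg_mem hq
  exact coeff_mem_of_coeff_two_mem hf hα e0 e1 ha (mem_of_two_mul_mem h2 ha) j

/-- This is the trapezoidal rule. It holds for f, where both sides vanish, and for any quadratic,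
hence for their difference; the three low coefficients are thereby eliminated. -/
theorem two_mul_eval_sub_eval {f : B[X]} {α β : B} (hα : f.eval α = 0) (hβ : f.eval β = 0)
    (hα' : (derivative f).eval α = 0) (hβ' : (derivative f).eval β = 0) :
    2 * ((dropQuadratic f).eval β - (dropQuadratic f).eval α) =
      (β - α) * ((derivative (dropQuadratic f)).eval α +
        (derivative (dropQuadratic f)).eval β) := by
  rw [eval_eq_dropQuadratic] at hα hβ
  rw [eval_derivative_eq_dropQuadratic] at hα' hβ'
  linear_combination 2 * hβ - 2 * hα - (β - α) * (hα' + hβ')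

theorem coeff_comp_of_natDegree_le {S : Type*} [CommRing S] {p q : S[X]} {N : ℕ}
    (hp : p.natDegree ≤ N) (hq : q.natDegree ≤ 1) :
    (p.comp q).coeff N = p.coeff N * q.coeff 1 ^ N := by
  rw [comp, eval₂_eq_sum_range' C (Nat.lt_succ_of_le hp), finsetSum_coeff,
    Finset.sum_range_succ, Finset.sum_eq_zero, zero_add, coeff_C_mul]
  · have := coeff_pow_of_natDegree_le (m := N) hq
    rw [mul_one] at this
    rw [this]
  · intro i hi
    rw [Finset.mem_range] at hi
    rw [coeff_C_mul, coeff_eq_zero_of_natDegree_lt (n := N), mul_zero]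
    calc (q ^ i).natDegree ≤ i * q.natDegree := natDegree_pow_le
      _ ≤ i * 1 := by gcongr
      _ < N := by omega

/-- As a polynomial in t, the expression has constant coefficient 1 - N and, as N ≥ 2, linear
coefficient N + 1. Their sum is 2, so they do not both vanish. -/
theorem exists_leading_coeff_ne_zero [Infinite K] (h2 : (2 : K) ≠ 0) (N : ℕ) (hN : 2 ≤ N) :
    ∃ t : K, 2 * (1 - t ^ (N + 1)) - (1 - t) * ((N + 1 : ℕ) * (t ^ N + 1)) ≠ 0 := by
  by_contra! h
  obtain ⟨M, rfl⟩ := Nat.exists_eq_add_of_le' hN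
  have hp : (C 2 * (1 - X ^ (M + 2 + 1)) -
      (1 - X) * (C ((M + 2 + 1 : ℕ) : K) * (X ^ (M + 2) + 1)) : K[X]) = 0 := by
    apply Polynomial.funext
    intro t
    simpa using h t
  have h0 := congrArg (eval 0) hp
  have h1 := congrArg (fun p => eval 0 (derivative p)) hp
  simp at h0 h1
  apply h2
  linear_combination h0 + h1

/-- With α = γ + tβ, the trapezoidal relation becomes an equation for β over `A` of degree at most N
+ 1, whose coefficient in that degree is the nonzero constant in `ht`. -/
theorem isIntegral_of_relation {A : Subalgebra K B} {g : B[X]} {N : ℕ} (hg : ∀ j, g.coeff j ∈ A)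
    (hdeg : g.natDegree ≤ N + 1) (hcoeff : g.coeff (N + 1) = 1) {γ β : B} (hγ : γ ∈ A) {t : K}
    (ht : 2 * (1 - t ^ (N + 1)) - (1 - t) * ((N + 1 : ℕ) * (t ^ N + 1)) ≠ 0)
    (hrel : 2 * (g.eval β - g.eval (γ + algebraMap K B t * β)) =
      (β - (γ + algebraMap K B t * β)) * ((derivative g).eval (γ + algebraMap K B t * β) +
        (derivative g).eval β)) : IsIntegral A β := by
  nontriviality B
  have hinj : Function.Injective (algebraMap A B) := Subtype.val_injective
  obtain ⟨g₀, rfl⟩ := mem_lifts_of_coeff_mem hg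
  rw [coe_mapRingHom] at hdeg hcoeff hrel
  rw [natDegree_map_eq_of_injective hinj] at hdeg
  have hcoeff₀ : g₀.coeff (N + 1) = 1 := by
    apply hinj
    rw [map_one, ← coeff_map, ← hcoeff]
  let γ₀ : A := ⟨γ, hγ⟩
  let L : A[X] := C γ₀ + C (algebraMap K A t) * X
  have hL : L.natDegree ≤ 1 :=
    (natDegree_add_le _ _).trans (max_le (by simp) ((natDegree_C_mul_le _ _).trans natDegree_X_le))
  have hL1 : L.coeff 1 = algebraMap K A t := by simp [L, coeff_C]
  have hd : (derivative g₀).natDegree ≤ N := by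
    have := natDegree_derivative_le g₀
    omega
  have hdcoeff : (derivative g₀).coeff N = ((N + 1 : ℕ) : A) := by
    rw [coeff_derivative, hcoeff₀]
    simp
  have hcomp : ∀ (p : A[X]) (M : ℕ), p.natDegree ≤ M → (p.comp L).natDegree ≤ M := fun p M hp =>
    calc (p.comp L).natDegree ≤ p.natDegree * L.natDegree := natDegree_comp_le
      _ ≤ M * 1 := by gcongr
      _ = M := mul_one M
  have hX : (X - L).natDegree ≤ 1 := (natDegree_sub_le _ _).trans (by simp [hL])
  have hsum : ((derivative g₀).comp L + derivative g₀).natDegree ≤ N :=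
    (natDegree_add_le _ _).trans (max_le (hcomp _ _ hd) hd)
  let P : A[X] := C 2 * (g₀ - g₀.comp L) - (X - L) * ((derivative g₀).comp L + derivative g₀)
  have hP : P.natDegree ≤ N + 1 := by
    refine (natDegree_sub_le _ _).trans (max_le ?_ ?_)
    · exact (natDegree_C_mul_le _ _).trans
        ((natDegree_sub_le _ _).trans (max_le hdeg (hcomp _ _ hdeg)))
    · exact natDegree_mul_le.trans (by omega)
  set c : K := 2 * (1 - t ^ (N + 1)) - (1 - t) * ((N + 1 : ℕ) * (t ^ N + 1)) with hc
  have hPc : P.coeff (N + 1) = algebraMap K A c := by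
    have h1 : ((X - L) * ((derivative g₀).comp L + derivative g₀)).coeff (N + 1) =
        (X - L).coeff 1 * ((derivative g₀).comp L + derivative g₀).coeff N := by
      rw [add_comm N 1]
      exact coeff_mul_add_eq_of_natDegree_le hX hsum
    simp only [P, coeff_sub, coeff_C_mul, h1, coeff_add, hL1, hcoeff₀, hdcoeff, coeff_X_one,
      coeff_comp_of_natDegree_le hdeg hL, coeff_comp_of_natDegree_le hd hL, hc]
    simp only [map_sub, map_mul, map_add, map_pow, map_one, map_natCast, map_ofNat]
    ring
  refine ⟨C (algebraMap K A c⁻¹) * P, ?_, ?_⟩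
  · apply monic_of_natDegree_le_of_coeff_eq_one (N + 1) ((natDegree_C_mul_le _ _).trans hP)
    rw [coeff_C_mul, hPc, ← map_mul, inv_mul_cancel₀ ht, map_one]
  · have hLβ : eval₂ (algebraMap A B) β L = γ + algebraMap K B t * β := by
      simp only [L, eval₂_add, eval₂_mul, eval₂_C, eval₂_X]
      rfl
    rw [eval₂_mul]
    convert mul_zero _
    simp only [P, eval₂_sub, eval₂_mul, eval₂_add, eval₂_X, eval₂_comp, eval₂_C, hLβ]
    simp only [eval_map, derivative_map] at hrel
    rw [map_ofNat]
    linear_combination hrel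

theorem isIntegral_of_monic_of_coeff_mem {R : Type*} [CommRing R] [Algebra R B] {A : Subalgebra R B}
    {p : B[X]} (hp : p.Monic) (hc : ∀ j, p.coeff j ∈ A) {x : B} (hx : p.eval x = 0) :
    IsIntegral A x := by
  have hl : p ∈ lifts (algebraMap A B) := by
    rw [lifts_iff_coeff_lifts]
    exact fun j => ⟨⟨_, hc j⟩, rfl⟩
  obtain ⟨q, hq, -, hqm⟩ := lifts_and_natDegree_eq_and_monic hl hp
  refine ⟨q, hqm, ?_⟩
  rw [← eval_map, hq, hx]

theorem isIntegral_aeval_range {ι : Type*} (v : ι → B)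
    (h : Algebra.IsIntegral (MvPolynomial.aeval v : MvPolynomial ι K →ₐ[K] B).range B) :
    (MvPolynomial.aeval v : MvPolynomial ι K →ₐ[K] B).toRingHom.IsIntegral := by
  have h1 : (MvPolynomial.aeval v : MvPolynomial ι K →ₐ[K] B).rangeRestrict.toRingHom.IsIntegral :=
    RingHom.isIntegral_of_surjective _ (AlgHom.rangeRestrict_surjective _)
  exact h1.trans _ (algebraMap _ B) (algebraMap_isIntegral_iff.2 h)

/-- If all but the three lowest coefficients of `∏ (X - y s)` lie in the algebra generated by a
family `u`, and this polynomial has two double roots or a triple root, then the algebra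
generated by the `y s` is integral over an algebra with one more generator than `u`. -/
theorem exists_isIntegral_of_collisions [IsDomain B] [Infinite K] (h2 : (2 : K) ≠ 0) {n : ℕ}
    (hn : 3 < n) (y : Fin n → B) (hy : Algebra.adjoin K (Set.range y) = ⊤) {ι : Type*} (u : ι → B)
    (hu : ∀ j, 3 ≤ j → (∏ s, (X - C (y s))).coeff j ∈ Algebra.adjoin K (Set.range u))
    {i j k l : Fin n} (hij : i ≠ j) (hkl : k ≠ l) (hki : k ≠ i) (hli : l ≠ i) (h : y i = y j)
    (h' : y k = y l) :
    ∃ v : Option ι → B,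
      (MvPolynomial.aeval v : MvPolynomial (Option ι) K →ₐ[K] B).toRingHom.IsIntegral := by
  classical
  set f : B[X] := ∏ s, (X - C (y s)) with hf
  have hroot : ∀ s, f.eval (y s) = 0 := fun s => by
    rw [hf, eval_prod]
    exact Finset.prod_eq_zero (Finset.mem_univ s) (by simp)
  have hdouble : ∀ s s', s ≠ s' → y s = y s' → (derivative f).eval (y s) = 0 := fun s s' hs he => by
    have hd : (X - C (y s)) ^ 2 ∣ f := by
      have := Finset.prod_dvd_prod_of_subset {s, s'} Finset.univ (fun s => X - C (y s))
        (Finset.subset_univ _)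
      rwa [Finset.prod_pair hs, ← he, ← pow_two] at this
    obtain ⟨q, hq⟩ := hd
    simp [hq, derivative_pow]
  have hmonic : f.Monic := monic_prod_X_sub_C y Finset.univ
  have hnat : f.natDegree = n := by
    rw [hf, natDegree_prod_of_monic _ _ fun s _ => monic_X_sub_C (y s)]
    simp
  obtain ⟨N, rfl⟩ : ∃ N, n = N + 1 := ⟨n - 1, by omega⟩
  obtain ⟨t, ht⟩ := exists_leading_coeff_ne_zero h2 N (by omega)
  let γ : B := y i - algebraMap K B t * y k
  let v : Option ι → B := fun o => o.elim γ u
  refine ⟨v, isIntegral_aeval_range v ?_⟩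
  set A := (MvPolynomial.aeval v : MvPolynomial (Option ι) K →ₐ[K] B).range with hA
  have hγ : γ ∈ A := ⟨MvPolynomial.X none, by simp [v]⟩
  have huA : Algebra.adjoin K (Set.range u) ≤ A := by
    rw [Algebra.adjoin_le_iff]
    rintro _ ⟨s, rfl⟩
    exact ⟨MvPolynomial.X (some s), by simp [v]⟩
  let A' : Subalgebra K B := (integralClosure A B).restrictScalars K
  have hAA' : A ≤ A' := fun x hx => isIntegral_algebraMap (R := A) (A := B) (x := ⟨x, hx⟩)
  have hα : y i = γ + algebraMap K B t * y k := by simp [γ]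
  have hcoeff : ∀ j, f.coeff j ∈ A' := by
    by_cases hik : y i = y k
    -- The pairs {i, j} and {k, l} may share j, but one of k, l is always a third index.
    · have htriple : ∃ s, s ≠ i ∧ s ≠ j ∧ y s = y i := by
        by_cases hkj : k = j
        · exact ⟨l, hli, fun hlj => hkl (hkj.trans hlj.symm), by rw [hik, h']⟩
        · exact ⟨k, hki, hkj, hik.symm⟩
      obtain ⟨s, hsi, hsj, hs⟩ := htriple
      have hd : (X - C (y i)) ^ 3 ∣ f := by
        have := Finset.prod_dvd_prod_of_subset {s, i, j} Finset.univ (fun s => X - C (y s))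
          (Finset.subset_univ _)
        rw [Finset.prod_insert (by simp [hsi, hsj]), Finset.prod_pair hij, hs, ← h] at this
        convert this using 1
        ring
      have hαA : y i ∈ A := by
        have he : γ = algebraMap K B (1 - t) * y i := by
          simp only [γ, map_sub, map_one]
          rw [hik]
          ring
        -- The expression in `ht` vanishes at t = 1, so 1 - t is invertible.
        by_cases ht1 : 1 - t = 0
        · obtain rfl : t = 1 := (sub_eq_zero.1 ht1).symm
          simp at ht
        · have : y i = (1 - t)⁻¹ • γ := by
            rw [he, Algebra.smul_def, ← mul_assoc, ← map_mul, inv_mul_cancel₀ ht1, map_one, one_mul]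
          rw [this]
          exact A.smul_mem hγ _
      exact coeff_mem_of_triple_root h2 (fun j hj => hAA' (huA (hu j hj))) (hAA' hαA) hd
    · have hβ : y k ∈ A' := by
        refine isIntegral_of_relation (g := dropQuadratic f) (N := N)
          (coeff_dropQuadratic_mem fun j hj => huA (hu j hj)) ?_ ?_ hγ ht ?_
        · rw [natDegree_le_iff_coeff_eq_zero]
          intro M hM
          rw [coeff_dropQuadratic_of_le f (by omega)]
          exact coeff_eq_zero_of_natDegree_lt (by omega)
        · rw [coeff_dropQuadratic_of_le f (by omega), ← hnat]
          exact hmonic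
        · rw [← hα]
          exact two_mul_eval_sub_eval (hroot i) (hroot k) (hdouble i j hij h) (hdouble k l hkl h')
      have hαA : y i ∈ A' := by
        rw [hα]
        exact add_mem (hAA' hγ) (mul_mem (A'.algebraMap_mem t) hβ)
      exact coeff_mem_of_double_roots h2 (fun j hj => hAA' (huA (hu j hj))) hαA hβ hik (hroot i)
        (hdouble i j hij h) (hdouble k l hkl h')
  have hyA : ∀ s, y s ∈ A' := fun s => by
    have h1 : IsIntegral (integralClosure A B) (y s) :=
      isIntegral_of_monic_of_coeff_mem hmonic hcoeff (hroot s)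
    exact isIntegral_trans (R := A) (y s) h1
  have htop : A' = ⊤ := by
    rw [eq_top_iff, ← hy, Algebra.adjoin_le_iff]
    rintro _ ⟨s, rfl⟩
    exact hyA s
  exact ⟨fun x => (htop ▸ Algebra.mem_top : x ∈ A')⟩

end DoubleRoots

/-! ### Linear parts and complementary linear combinations -/

section LinearSystems

open MvPolynomial

/-- The coefficients of the linear part of a polynomial. -/
noncomputable def linearPart {F σ : Type*} [Field F] (p : MvPolynomial σ F) : σ → F :=
  fun k => coeff (Finsupp.single k 1) p

theorem homogeneousComponent_one_eq {F σ : Type*} [Field F] [Fintype σ] (p : MvPolynomial σ F) :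
    homogeneousComponent 1 p = Fintype.linearCombination F (fun k => (X k : MvPolynomial σ F))
      (linearPart p) := by
  classical
  ext d
  rw [coeff_homogeneousComponent, Fintype.linearCombination_apply, coeff_sum]
  simp only [coeff_smul, coeff_X, smul_eq_mul, mul_ite, mul_one, mul_zero, linearPart]
  split_ifs with hd
  · obtain ⟨k, rfl⟩ : ∃ k, Finsupp.single k 1 = d := by
      have hne : d ≠ 0 := by
        rintro rfl
        simp at hd
      obtain ⟨k, hk⟩ := Finsupp.ne_iff.1 hne
      have hle : Finsupp.single k 1 ≤ d := by
        rw [Finsupp.single_le_iff]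
        exact Nat.one_le_iff_ne_zero.2 hk
      refine ⟨k, ?_⟩
      obtain ⟨c, rfl⟩ := exists_add_of_le hle
      rw [map_add, Finsupp.degree_single] at hd
      rw [(Finsupp.degree_eq_zero_iff c).1 (by omega), add_zero]
    rw [Finset.sum_eq_single k]
    · simp
    · intro l _ hl
      rw [if_neg]
      exact fun h => hl (Finsupp.single_left_injective one_ne_zero h)
    · simp
  · refine (Finset.sum_eq_zero fun k _ => if_neg ?_).symm
    rintro rfl
    simp at hd

theorem aeval_of_totalDegree_eq_one {F σ B : Type*} [Field F] [Fintype σ] [CommRing B] [Algebra F B]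
    (p : MvPolynomial σ F) (hp : p.totalDegree = 1) (e : σ → B) :
    aeval e p = algebraMap F B (coeff 0 p) + ∑ k, linearPart p k • e k := by
  conv_lhs => rw [← sum_homogeneousComponent p, hp]
  rw [Finset.sum_range_succ, Finset.sum_range_one, homogeneousComponent_zero,
    homogeneousComponent_one_eq, Fintype.linearCombination_apply]
  simp

theorem linearIndependent_linearPart {F σ : Type*} [Field F] [Fintype σ] {m : ℕ}
    (S : Fin m → MvPolynomial σ F)
    (hS : LinearIndependent F fun j => homogeneousComponent 1 (S j)) :
    LinearIndependent F fun j => linearPart (S j) := by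
  have h : (fun j => homogeneousComponent 1 (S j)) =
      (Fintype.linearCombination F (fun k => (X k : MvPolynomial σ F))) ∘
        fun j => linearPart (S j) := by
    ext1 j
    exact homogeneousComponent_one_eq (S j)
  rw [h] at hS
  exact hS.of_comp _

/-- The coefficient vectors of `u` form a basis of a complement of the span of `a`, so together with
`a` they span all coefficient vectors. -/
theorem exists_complementary_combinations {K B σ : Type*} [Field K] [CommRing B] [Algebra K B]
    [Fintype σ] {m d : ℕ} (hd : Fintype.card σ = m + d) (a : Fin m → σ → K)
    (ha : LinearIndependent K a) (e : σ → B) : ∃ u : Fin d → B, ∀ A : Subalgebra K B,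
      (∀ j, ∑ k, a j k • e k ∈ A) → (∀ i, u i ∈ A) → ∀ k, e k ∈ A := by
  classical
  obtain ⟨D, hD⟩ := exists_isCompl (Submodule.span K (Set.range a))
  have hfin : Module.finrank K D = d := by
    have h1 := Submodule.finrank_add_eq_of_isCompl hD
    rw [finrank_span_eq_card ha, Fintype.card_fin, Module.finrank_fintype_fun_eq_card] at h1
    omega
  let b := Module.finBasisOfFinrankEq K D hfin
  let φ := Fintype.linearCombination K e
  refine ⟨fun i => φ (b i), fun A hA hu k => ?_⟩
  have htop : (Subalgebra.toSubmodule A).comap φ = ⊤ := by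
    rw [eq_top_iff, ← hD.sup_eq_top, sup_le_iff]
    constructor
    · rw [Submodule.span_le]
      rintro _ ⟨j, rfl⟩
      exact hA j
    · intro v hv
      have hsum := b.sum_repr ⟨v, hv⟩
      have hv' : v = ∑ i, b.repr ⟨v, hv⟩ i • (b i : σ → K) := by
        conv_lhs => rw [show v = ((⟨v, hv⟩ : D) : σ → K) from rfl, ← hsum]
        simp only [Submodule.coe_sum, Submodule.coe_smul]
      rw [hv']
      exact Submodule.sum_mem _ fun i _ => Submodule.smul_mem _ _ (hu i)
  have hk : Pi.single k (1 : K) ∈ (Subalgebra.toSubmodule A).comap φ := htop ▸ Submodule.mem_top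
  have hk' : φ (Pi.single k 1) ∈ A := hk
  simpa [φ] using hk'

end LinearSystems

/-! ### Elementary symmetric polynomials and their derivatives -/

section Symmetric

open MvPolynomial

theorem coeff_prod_X_sub_C {K B : Type*} [Field K] [CommRing B] [Algebra K B] {n : ℕ}
    (y : Fin n → B) {j : ℕ} (hj : j ≤ n) :
    (∏ s, (Polynomial.X - Polynomial.C (y s))).coeff j =
      (-1) ^ (n - j) * aeval y (esymm (Fin n) K (n - j)) := by
  have h := Multiset.prod_X_sub_C_coeff (Finset.univ.val.map y) (k := j) (by simpa using hj)
  rw [Multiset.map_map] at h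
  rw [aeval_esymm_eq_multiset_esymm]
  simp only [Multiset.card_map, Finset.card_val, Finset.card_univ, Fintype.card_fin] at h
  exact h

theorem coeff_prod_X_sub_C_mem {K B : Type*} [Field K] [CommRing B] [Algebra K B] {n : ℕ}
    (y : Fin n → B) (A : Subalgebra K B) {j : ℕ}
    (h : ∀ k, k + j < n → aeval y (esymm (Fin n) K (k + 1)) ∈ A) :
    (∏ s, (Polynomial.X - Polynomial.C (y s))).coeff j ∈ A := by
  nontriviality B
  rcases lt_trichotomy j n with hj | rfl | hj
  · rw [coeff_prod_X_sub_C (K := K) y hj.le]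
    obtain ⟨k, hk⟩ : ∃ k, n - j = k + 1 := ⟨n - j - 1, by omega⟩
    rw [hk]
    exact mul_mem (pow_mem (neg_mem (one_mem A)) _) (h k (by omega))
  · rw [coeff_prod_X_sub_C (K := K) y le_rfl]
    simp
  · rw [Polynomial.coeff_eq_zero_of_natDegree_lt]
    · exact zero_mem A
    · rw [Polynomial.natDegree_prod_of_monic _ _ fun s _ => Polynomial.monic_X_sub_C (y s)]
      simpa using hj

theorem isIntegral_of_esymm_mem {K : Type*} [Field K] {n : ℕ}
    (A : Subalgebra K (MvPolynomial (Fin n) K)) (h : ∀ k < n, esymm (Fin n) K (k + 1) ∈ A) :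
    Algebra.IsIntegral A (MvPolynomial (Fin n) K) := by
  let A' : Subalgebra K (MvPolynomial (Fin n) K) :=
    (integralClosure A (MvPolynomial (Fin n) K)).restrictScalars K
  have hX : ∀ s, X s ∈ A' := fun s => by
    refine isIntegral_of_monic_of_coeff_mem (A := A)
      (Polynomial.monic_prod_X_sub_C (X : Fin n → MvPolynomial (Fin n) K) Finset.univ)
      (fun j => coeff_prod_X_sub_C_mem _ A fun k hk => ?_) ?_
    · rw [aeval_X_left_apply]
      exact h k (by omega)
    · rw [Polynomial.eval_prod]
      exact Finset.prod_eq_zero (Finset.mem_univ s) (by simp)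
  have htop : A' = ⊤ := by
    rw [eq_top_iff, ← adjoin_range_X, Algebra.adjoin_le_iff]
    rintro _ ⟨s, rfl⟩
    exact hX s
  exact ⟨fun x => (htop ▸ Algebra.mem_top : x ∈ A')⟩

/-- With E_k the elementary symmetric polynomials in the other variables, Π_{k+1} = E_{k+1} + Y_i
E_k, so the derivative of Π_{k+1} is E_k. -/
theorem pderiv_esymm_succ {K : Type*} [Field K] {n : ℕ} (i : Fin n) (k : ℕ) :
    pderiv i (esymm (Fin n) K (k + 1)) =
      esymm (Fin n) K k - X i * pderiv i (esymm (Fin n) K k) := by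
  classical
  let E : ℕ → MvPolynomial (Fin n) K := fun k => ((Finset.univ.erase i).val.map X).esymm k
  have hE : ∀ k, pderiv i (E k) = 0 := fun k => by
    simp only [E, Finset.esymm_map_val, map_sum]
    refine Finset.sum_eq_zero fun t ht => ?_
    rw [Finset.mem_powersetCard] at ht
    refine Finset.prod_induction _ (fun f : MvPolynomial (Fin n) K => pderiv i f = 0) ?_ ?_ ?_
    · intro f g hf hg
      simp [Derivation.leibniz, hf, hg]
    · simp
    · intro s hs
      exact pderiv_X_of_ne (Finset.ne_of_mem_erase (ht.1 hs))
  have hsucc : ∀ k, esymm (Fin n) K (k + 1) = E (k + 1) + X i * E k := fun k => by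
    rw [esymm_eq_multiset_esymm]
    have : (Finset.univ : Finset (Fin n)).val = i ::ₘ (Finset.univ.erase i).val := by
      rw [← Finset.insert_val_of_notMem (Finset.notMem_erase i _),
        Finset.insert_erase (Finset.mem_univ i)]
    rw [this, Multiset.map_cons]
    simp only [E, Multiset.esymm, Multiset.powersetCard_cons, Multiset.map_add, Multiset.sum_add,
      Multiset.map_map, Function.comp_def, Multiset.prod_cons, Multiset.sum_map_mul_left]
  have hd : ∀ k, pderiv i (esymm (Fin n) K (k + 1)) = E k := fun k => by
    rw [hsucc, map_add, hE, Derivation.leibniz, hE, pderiv_X_self]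
    simp
  rw [hd]
  cases k with
  | zero => simp [E, Multiset.esymm]
  | succ k =>
    rw [hd, hsucc]
    ring

/-- A polynomial taking the value `∂Π_{k+1}/∂Y_i (y)` at `y i`, for every `i`. -/
noncomputable def esymmDerivPolynomial {K : Type*} [Field K] {n : ℕ} (y : Fin n → K) :
    ℕ → Polynomial K
  | 0 => 1
  | k + 1 => Polynomial.C (eval y (esymm (Fin n) K (k + 1))) -
      Polynomial.X * esymmDerivPolynomial y k

theorem eval_esymmDerivPolynomial {K : Type*} [Field K] {n : ℕ} (y : Fin n → K) (i : Fin n)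
    (k : ℕ) : (esymmDerivPolynomial y k).eval (y i) =
      eval y (pderiv i (esymm (Fin n) K (k + 1))) := by
  induction k with
  | zero => simp [esymmDerivPolynomial]
  | succ k ih =>
    rw [pderiv_esymm_succ, esymmDerivPolynomial]
    simp [ih]

theorem natDegree_esymmDerivPolynomial_le {K : Type*} [Field K] {n : ℕ} (y : Fin n → K) (k : ℕ) :
    (esymmDerivPolynomial y k).natDegree ≤ k := by
  induction k with
  | zero => simp [esymmDerivPolynomial]
  | succ k ih =>
    refine (Polynomial.natDegree_sub_le _ _).trans (max_le (by simp) ?_)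
    refine Polynomial.natDegree_mul_le.trans ?_
    rw [Polynomial.natDegree_X]
    omega

theorem coeff_esymmDerivPolynomial {K : Type*} [Field K] {n : ℕ} (y : Fin n → K) (k : ℕ) :
    (esymmDerivPolynomial y k).coeff k = (-1) ^ k := by
  induction k with
  | zero => simp [esymmDerivPolynomial]
  | succ k ih =>
    rw [esymmDerivPolynomial, Polynomial.coeff_sub, Polynomial.coeff_C_succ,
      Polynomial.coeff_X_mul, ih]
    ring

/-- The polynomials `esymmDerivPolynomial y k` have distinct exact degrees k < N, so their
combination by `b` is nonzero of degree less than N; every y_i is a root. -/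
theorem card_image_lt_of_sum_pderiv_esymm_eq_zero {K : Type*} [Field K] [DecidableEq K] {n N : ℕ}
    (y : Fin n → K) (b : Fin N → K) (hb : b ≠ 0)
    (h : ∀ i, ∑ k, b k * eval y (pderiv i (esymm (Fin n) K ((k : ℕ) + 1))) = 0) :
    (Finset.univ.image y).card < N := by
  classical
  let P : Polynomial K := ∑ k : Fin N, Polynomial.C (b k) * esymmDerivPolynomial y k
  have hN : 0 < N := by
    by_contra h0
    obtain rfl : N = 0 := by omega
    exact hb (Subsingleton.elim _ _)
  have hPdeg : P.natDegree ≤ N - 1 := by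
    refine Polynomial.natDegree_sum_le_of_forall_le _ _ fun k _ => ?_
    refine (Polynomial.natDegree_C_mul_le _ _).trans
      ((natDegree_esymmDerivPolynomial_le y k).trans ?_)
    omega
  have hP : P ≠ 0 := by
    have hne : (Finset.univ.filter fun k => b k ≠ 0).Nonempty := by
      obtain ⟨k, hk⟩ := Function.ne_iff.1 hb
      exact ⟨k, by simpa using hk⟩
    obtain ⟨k, hmax⟩ := Finset.exists_maximal hne
    have hkb : b k ≠ 0 := by simpa using hmax.prop
    intro hP0
    have hc : P.coeff k = b k * (-1) ^ (k : ℕ) := by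
      simp only [P, Polynomial.finsetSum_coeff, Polynomial.coeff_C_mul]
      rw [Finset.sum_eq_single k]
      · rw [coeff_esymmDerivPolynomial]
      · intro l _ hlk
        rcases lt_or_gt_of_ne hlk with hl | hl
        · rw [Polynomial.coeff_eq_zero_of_natDegree_lt, mul_zero]
          exact (natDegree_esymmDerivPolynomial_le y l).trans_lt hl
        · have : b l = 0 := by
            by_contra hbl
            exact absurd (hmax.le_of_ge (by simpa using hbl) hl.le) (not_le.2 hl)
          rw [this, zero_mul]
      · simp
    rw [hP0, Polynomial.coeff_zero] at hc
    exact mul_ne_zero hkb (pow_ne_zero _ (by simp)) hc.symm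
  have hroots : (Finset.univ.image y).val ⊆ P.roots := by
    intro z hz
    rw [Finset.mem_val, Finset.mem_image] at hz
    obtain ⟨i, -, rfl⟩ := hz
    rw [Polynomial.mem_roots hP, Polynomial.IsRoot, Polynomial.eval_finsetSum, ← h i]
    refine Finset.sum_congr rfl fun k _ => ?_
    rw [Polynomial.eval_mul, Polynomial.eval_C, eval_esymmDerivPolynomial]
  have := Polynomial.card_le_degree_of_subset_roots hroots
  omega

/-- Pigeonhole twice, the second time without i. Since j is kept, a triple coincidence is allowed.
-/
theorem exists_two_collisions {α : Type*} [DecidableEq α] {n : ℕ} (y : Fin n → α)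
    (h : (Finset.univ.image y).card + 2 ≤ n) :
    ∃ i j k l, i ≠ j ∧ k ≠ l ∧ k ≠ i ∧ l ≠ i ∧ y i = y j ∧ y k = y l := by
  obtain ⟨i, -, j, -, hij, hy⟩ := Finset.exists_ne_map_eq_of_card_lt_of_maps_to
    (s := Finset.univ) (t := Finset.univ.image y) (f := y) (by simp; omega)
    (fun x _ => by simp)
  obtain ⟨k, hk, l, hl, hkl, hy'⟩ := Finset.exists_ne_map_eq_of_card_lt_of_maps_to
    (s := Finset.univ.erase i) (t := Finset.univ.image y) (f := y)
    (by rw [Finset.card_erase_of_mem (Finset.mem_univ i)]; simp; omega)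
    (fun x _ => by simp)
  exact ⟨i, j, k, l, hij, hkl, Finset.ne_of_mem_erase hk, Finset.ne_of_mem_erase hl, hy, hy'⟩

end Symmetric

/-! ### Equidimensionality and the singular locus -/

section Components

open MvPolynomial

variable {K : Type*} [Field K] {n m : ℕ}

/-- `R` and n - r - m complementary combinations recover Π_1, …, Π_{n-r}; adjoining the last r
elementary symmetric polynomials gives all of them. -/
theorem exists_isIntegral_parameters {r : ℕ} (hrn : r + m ≤ n)
    (a : Fin m → Fin (n - r) → K) (ha : LinearIndependent K a) (c : Fin m → K)
    (R : Fin m → MvPolynomial (Fin n) K)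
    (hR : ∀ j, R j = C (c j) + ∑ k, a j k • esymm (Fin n) K ((k : ℕ) + 1)) :
    ∃ u : Fin (n - r - m) ⊕ Fin r → MvPolynomial (Fin n) K,
      (aeval (Sum.elim R u) : MvPolynomial (Fin m ⊕ (Fin (n - r - m) ⊕ Fin r)) K →ₐ[K]
        MvPolynomial (Fin n) K).toRingHom.IsIntegral := by
  obtain ⟨u, hu⟩ := exists_complementary_combinations (d := n - r - m)
    (by rw [Fintype.card_fin]; omega) a ha
    (fun k : Fin (n - r) => esymm (Fin n) K ((k : ℕ) + 1))
  let w : Fin m ⊕ (Fin (n - r - m) ⊕ Fin r) → MvPolynomial (Fin n) K :=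
    Sum.elim R (Sum.elim u fun t => esymm (Fin n) K (n - r + t + 1))
  refine ⟨_, isIntegral_aeval_range w (isIntegral_of_esymm_mem _ fun k hk => ?_)⟩
  have hw : ∀ x, w x ∈ (aeval w : MvPolynomial _ K →ₐ[K] MvPolynomial (Fin n) K).range :=
    fun x => ⟨X x, by simp⟩
  by_cases hkr : k < n - r
  · refine hu _ (fun j => ?_) (fun i => hw (Sum.inr (Sum.inl i))) ⟨k, hkr⟩
    rw [show ∑ k, a j k • esymm (Fin n) K ((k : ℕ) + 1) = R j - C (c j) by rw [hR]; ring]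
    exact sub_mem (hw (Sum.inl j)) (Subalgebra.algebraMap_mem _ _)
  · have h := hw (Sum.inr (Sum.inr ⟨k - (n - r), by omega⟩))
    simp only [w, Sum.elim_inr] at h
    rwa [Nat.add_sub_cancel' (not_lt.1 hkr)] at h

/-- Over a minimal prime of a system `R` that extends to a system of parameters `(R, u)` over which
the polynomial ring is integral, the `u` form a Noether normalization. -/
theorem isIntegral_and_injective_of_mem_minimalPrimes {τ : Type*} [Finite τ]
    (hτ : m + Nat.card τ = n) (R : Fin m → MvPolynomial (Fin n) K)
    (u : τ → MvPolynomial (Fin n) K)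
    (hint : (aeval (Sum.elim R u) : MvPolynomial (Fin m ⊕ τ) K →ₐ[K]
      MvPolynomial (Fin n) K).toRingHom.IsIntegral)
    (P : Ideal (MvPolynomial (Fin n) K)) (hP : P ∈ (Ideal.span (Set.range R)).minimalPrimes) :
    ((Ideal.Quotient.mk P).comp (aeval u : MvPolynomial τ K →ₐ[K]
      MvPolynomial (Fin n) K).toRingHom).IsIntegral ∧
    Function.Injective ((Ideal.Quotient.mk P).comp (aeval u : MvPolynomial τ K →ₐ[K]
      MvPolynomial (Fin n) K).toRingHom) := by
  have hPp : P.IsPrime := hP.1.1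
  set φ := (aeval (Sum.elim R u) : MvPolynomial (Fin m ⊕ τ) K →ₐ[K]
    MvPolynomial (Fin n) K).toRingHom with hφ
  set ψ := (Ideal.Quotient.mk P).comp (aeval u : MvPolynomial τ K →ₐ[K]
    MvPolynomial (Fin n) K).toRingHom with hψ
  -- `κ` kills the variables that map to `R`, so modulo `P` the map `φ` factors through it.
  let κ : MvPolynomial (Fin m ⊕ τ) K →+* MvPolynomial τ K :=
    (aeval (Sum.elim (fun _ => 0) X) : MvPolynomial (Fin m ⊕ τ) K →ₐ[K] MvPolynomial τ K).toRingHom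
  have hRP : ∀ j, R j ∈ P := fun j => hP.1.2 (Ideal.subset_span ⟨j, rfl⟩)
  have hcomm : (Ideal.Quotient.mk P).comp φ = ψ.comp κ := by
    apply MvPolynomial.ringHom_ext
    · intro x
      simp [hφ, hψ, κ]
    · rintro (j | i)
      · simp [hφ, hψ, κ, Ideal.Quotient.eq_zero_iff_mem.2 (hRP j)]
      · simp [hφ, hψ, κ]
  refine ⟨?_, ?_⟩
  · refine RingHom.IsIntegral.tower_top κ ψ ?_
    rw [← hcomm]
    exact hint.trans _ _ (RingHom.isIntegral_of_surjective _ Ideal.Quotient.mk_surjective)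
  · have hφinj : Function.Injective φ := by
      refine injective_of_isIntegral_of_card_le φ hint ?_
      rw [ringKrullDim_mvPolynomial_field]
      simp [Nat.card_sum, hτ]
    algebraize [φ]
    have : FaithfulSMul (MvPolynomial (Fin m ⊕ τ) K) (MvPolynomial (Fin n) K) :=
      (faithfulSMul_iff_algebraMap_injective _ _).2 hφinj
    have hκ : (RingHom.ker κ).IsPrime := RingHom.ker_isPrime κ
    have hle : RingHom.ker κ ≤ P.under (MvPolynomial (Fin m ⊕ τ) K) := by
      intro x hx
      have hx' : (Ideal.Quotient.mk P) (φ x) = 0 := by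
        have := congrArg (fun f => f x) hcomm
        simp only [RingHom.comp_apply] at this
        rw [this, (RingHom.mem_ker).1 hx, map_zero]
      have hxP : φ x ∈ P := Ideal.Quotient.eq_zero_iff_mem.1 hx'
      exact hxP
    have hlie : P.LiesOver (P.under (MvPolynomial (Fin m ⊕ τ) K)) := ⟨rfl⟩
    -- Going-down gives a prime below `P` over ker `κ`. It contains `R`, so by minimality it is `P`,
    -- and `P` contracts exactly to ker `κ`.
    obtain ⟨P', hP'P, hP', hP'κ⟩ := Ideal.exists_ideal_le_liesOver_of_le P hle
    have hRP' : Ideal.span (Set.range R) ≤ P' := by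
      rw [Ideal.span_le]
      rintro _ ⟨j, rfl⟩
      have h1 : (X (Sum.inl j) : MvPolynomial (Fin m ⊕ τ) K) ∈ RingHom.ker κ := by
        rw [RingHom.mem_ker]
        simp [κ]
      rw [hP'κ.over] at h1
      have h2 : φ (X (Sum.inl j)) ∈ P' := h1
      simpa [hφ] using h2
    have hPP' : P' = P := le_antisymm hP'P (hP.2 ⟨hP', hRP'⟩ hP'P)
    subst hPP'
    rw [injective_iff_map_eq_zero]
    intro f hf
    have h1 : κ (rename Sum.inr f) = f := by
      simp only [κ, AlgHom.toRingHom_eq_coe, RingHom.coe_coe, aeval_rename]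
      exact aeval_X_left_apply f
    have h2 : rename Sum.inr f ∈ RingHom.ker κ := by
      rw [hP'κ.over]
      change φ (rename Sum.inr f) ∈ P'
      rw [← Ideal.Quotient.eq_zero_iff_mem]
      have := congrArg (fun g => g (rename Sum.inr f)) hcomm
      simp only [RingHom.comp_apply] at this
      rw [this, h1]
      exact hf
    rw [← h1]
    exact h2

theorem commonZeros_eq_zeroLocus (R : Fin m → MvPolynomial (Fin n) K) :
    commonZeros R = zeroLocus K (Ideal.span (Set.range R)) := by
  rw [zeroLocus_span]
  ext y
  simp [commonZeros, aeval_eq_eval]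

variable [IsAlgClosed K]

theorem minimalPrimes_vanishingIdeal_commonZeros (R : Fin m → MvPolynomial (Fin n) K) :
    (vanishingIdeal K (commonZeros R)).minimalPrimes =
      (Ideal.span (Set.range R)).minimalPrimes := by
  rw [commonZeros_eq_zeroLocus, vanishingIdeal_zeroLocus_eq_radical, Ideal.radical_minimalPrimes]

/-- The Jacobian criterion: if the polynomial ring is integral over the system `R` extended by
`n - m` parameters, then the singular points of `V(R)` are points where the Jacobian matrix
does not have full rank. -/
theorem singularLocus_subset {τ : Type*} [Finite τ]
    (hτ : m + Nat.card τ = n) (R : Fin m → MvPolynomial (Fin n) K)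
    (u : τ → MvPolynomial (Fin n) K)
    (hint : (aeval (Sum.elim R u) : MvPolynomial (Fin m ⊕ τ) K →ₐ[K]
      MvPolynomial (Fin n) K).toRingHom.IsIntegral) :
    singularLocus (commonZeros R) ⊆
      {y | y ∈ commonZeros R ∧ (jacobian R y).rank < m} := by
  rintro y ⟨hy, hne⟩
  refine ⟨hy, lt_of_le_of_ne ?_ fun hrank => hne ?_⟩
  · simpa using (jacobian R y).rank_le_card_height
  have hV : IsVariety (commonZeros R) := ⟨_, commonZeros_eq_zeroLocus R⟩
  have hdim : ∀ P ∈ (vanishingIdeal K (commonZeros R)).minimalPrimes,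
      ringKrullDim (MvPolynomial (Fin n) K ⧸ P) = Nat.card τ := fun P hP => by
    rw [minimalPrimes_vanishingIdeal_commonZeros] at hP
    have hPp : P.IsPrime := hP.1.1
    obtain ⟨h1, h2⟩ := isIntegral_and_injective_of_mem_minimalPrimes hτ R u hint P hP
    exact ringKrullDim_eq_of_isIntegral _ h1 h2
  rw [dimensionAt_eq hV _ hdim hy]
  have hle := finrank_tangentSpace_le R y hrank
  obtain ⟨P, hP, hPy⟩ := Ideal.exists_minimalPrimes_le (J := vanishingIdeal K {y})
    (vanishingIdeal_anti_mono (k := K) (Set.singleton_subset_iff.2 hy))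
  have hPp : P.IsPrime := hP.1.1
  have hM : ((vanishingIdeal K {y}).map (Ideal.Quotient.mk P)).IsMaximal :=
    Ideal.IsMaximal.map_of_surjective_of_ker_le Ideal.Quotient.mk_surjective (by
      rwa [Ideal.mk_ker])
  have hge := height_le_finrank_tangentSpace (commonZeros R) y P hP.1.2 hPy hM
  rw [minimalPrimes_vanishingIdeal_commonZeros] at hP
  obtain ⟨h1, h2⟩ := isIntegral_and_injective_of_mem_minimalPrimes hτ R u hint P hP
  have h3 := (card_le_height_of_isIntegral _ h1 h2 _).trans hge
  have h4 : Nat.card τ ≤ Module.finrank K (tangentSpace (commonZeros R) y) := by exact_mod_cast h3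
  have h5 : Module.finrank K (tangentSpace (commonZeros R) y) = Nat.card τ := by omega
  rw [h5]

theorem le_dimension_commonZeros {τ : Type*} [Finite τ]
    (hτ : m + Nat.card τ = n) (R : Fin m → MvPolynomial (Fin n) K)
    (u : τ → MvPolynomial (Fin n) K)
    (hint : (aeval (Sum.elim R u) : MvPolynomial (Fin m ⊕ τ) K →ₐ[K]
      MvPolynomial (Fin n) K).toRingHom.IsIntegral) (hne : (commonZeros R).Nonempty) :
    (Nat.card τ : WithBot ℕ∞) ≤ dimension (commonZeros R) := by
  obtain ⟨y, hy⟩ := hne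
  obtain ⟨P, hP, hPy⟩ := Ideal.exists_minimalPrimes_le (J := vanishingIdeal K {y})
    (vanishingIdeal_anti_mono (k := K) (Set.singleton_subset_iff.2 hy))
  have hPp : P.IsPrime := hP.1.1
  rw [dimension_eq_ringKrullDim]
  have hsurj := ringKrullDim_le_of_surjective (Ideal.Quotient.factor hP.1.2)
    (Ideal.Quotient.factor_surjective hP.1.2)
  refine le_trans ?_ hsurj
  rw [minimalPrimes_vanishingIdeal_commonZeros] at hP
  obtain ⟨h1, h2⟩ := isIntegral_and_injective_of_mem_minimalPrimes hτ R u hint P hP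
  exact (ringKrullDim_eq_of_isIntegral _ h1 h2).ge

end Components

/-! ### Dimension of the rank-deficient locus -/

section RankDeficient

open MvPolynomial

variable {K : Type*} [Field K] {n m r : ℕ}

/-- A dependence g of the Jacobian rows is a relation among the gradients of the Π_k with
coefficients ∑ g_j a_j, nonzero because `a` is independent. -/
theorem exists_collisions_of_rank_lt (hr : 3 ≤ r) (hrn : r ≤ n)
    (a : Fin m → Fin (n - r) → K) (ha : LinearIndependent K a) (c : Fin m → K)
    (R : Fin m → MvPolynomial (Fin n) K)
    (hR : ∀ j, R j = C (c j) + ∑ k, a j k • esymm (Fin n) K ((k : ℕ) + 1))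
    (y : Fin n → K) (hrank : (jacobian R y).rank < m) :
    ∃ i j k l, i ≠ j ∧ k ≠ l ∧ k ≠ i ∧ l ≠ i ∧ y i = y j ∧ y k = y l := by
  classical
  have hdep : ¬ LinearIndependent K (jacobian R y).row := fun h => by
    have := h.rank_matrix
    rw [Fintype.card_fin] at this
    omega
  obtain ⟨g, hg, j₀, hj₀⟩ := Fintype.not_linearIndependent_iff.1 hdep
  have hb : ∑ j, g j • a j ≠ 0 := fun h => hj₀ (Fintype.linearIndependent_iff.1 ha g h j₀)
  have hcard := card_image_lt_of_sum_pderiv_esymm_eq_zero y _ hb fun i => by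
    have h1 := congrFun hg i
    simp only [Finset.sum_apply, Pi.smul_apply, smul_eq_mul, Matrix.row, jacobian, Matrix.of_apply,
      Pi.zero_apply, hR, map_add, map_sum, Derivation.map_smul, pderiv_C, zero_add, smul_eval]
      at h1
    simp only [Finset.sum_apply, Pi.smul_apply, smul_eq_mul, Finset.sum_mul]
    rw [Finset.sum_comm, ← h1]
    refine Finset.sum_congr rfl fun j _ => ?_
    rw [Finset.mul_sum]
    exact Finset.sum_congr rfl fun k _ => by ring
  exact exists_two_collisions y (by omega)

theorem ringKrullDim_quotient_le_of_collisions [Infinite K] (h2 : (2 : K) ≠ 0)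
    (hr : 3 ≤ r) (hrn : r + m ≤ n) (hn : 3 < n)
    (a : Fin m → Fin (n - r) → K) (ha : LinearIndependent K a) (c : Fin m → K)
    (R : Fin m → MvPolynomial (Fin n) K)
    (hR : ∀ j, R j = C (c j) + ∑ k, a j k • esymm (Fin n) K ((k : ℕ) + 1))
    (Q : Ideal (MvPolynomial (Fin n) K)) [Q.IsPrime] (hRQ : ∀ j, R j ∈ Q)
    {i j k l : Fin n} (hij : i ≠ j) (hkl : k ≠ l) (hki : k ≠ i) (hli : l ≠ i)
    (h : X i - X j ∈ Q) (h' : X k - X l ∈ Q) :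
    ringKrullDim (MvPolynomial (Fin n) K ⧸ Q) ≤ (n - m - 2 : ℕ) := by
  let π := Ideal.Quotient.mkₐ K Q
  let y : Fin n → MvPolynomial (Fin n) K ⧸ Q := fun s => π (X s)
  have hπ : ∀ p, aeval y p = π p := fun p => by
    have : (aeval y : MvPolynomial (Fin n) K →ₐ[K] _) = π := by
      apply MvPolynomial.algHom_ext
      intro s
      simp [y]
    rw [this]
  have hy : Algebra.adjoin K (Set.range y) = ⊤ := by
    rw [eq_top_iff]
    rintro x -
    obtain ⟨p, rfl⟩ := Ideal.Quotient.mkₐ_surjective K Q x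
    rw [Algebra.adjoin_range_eq_range_aeval]
    exact ⟨p, hπ p⟩
  obtain ⟨u, hu⟩ := exists_complementary_combinations (d := n - r - m)
    (by rw [Fintype.card_fin]; omega) a ha
    (fun k : Fin (n - r) => π (esymm (Fin n) K ((k : ℕ) + 1)))
  -- The second block is Π_{n-r+1}, …, Π_{n-3}; the last three Π_k are the coefficients of index 0,
  -- 1, 2, which the collisions supply. With one extra generator the count is (n - r - m) + (r - 3)
  -- + 1 = n - m - 2.
  let u' : Fin (n - r - m) ⊕ Fin (r - 3) → MvPolynomial (Fin n) K ⧸ Q :=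
    Sum.elim u fun t => π (esymm (Fin n) K (n - r + t + 1))
  have hmem : ∀ k, k + 3 < n →
      π (esymm (Fin n) K (k + 1)) ∈ Algebra.adjoin K (Set.range u') := by
    intro k hk
    by_cases hkr : k < n - r
    · refine hu _ (fun j => ?_) (fun i => ?_) ⟨k, hkr⟩
      · have h0 : π (R j) = 0 := Ideal.Quotient.eq_zero_iff_mem.2 (hRQ j)
        rw [hR, map_add, map_sum] at h0
        simp only [map_smul] at h0
        rw [eq_neg_of_add_eq_zero_right h0]
        refine neg_mem ?_
        have hC : π (C (c j)) = algebraMap K _ (c j) := π.commutes (c j)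
        rw [hC]
        exact Subalgebra.algebraMap_mem _ _
      · exact Algebra.subset_adjoin ⟨Sum.inl i, rfl⟩
    · refine Algebra.subset_adjoin ⟨Sum.inr ⟨k - (n - r), by omega⟩, ?_⟩
      simp only [u', Sum.elim_inr]
      congr 3
      omega
  have hyy : ∀ i j, X i - X j ∈ Q → y i = y j := fun i j h => Ideal.Quotient.eq.2 h
  obtain ⟨v, hv⟩ := exists_isIntegral_of_collisions h2 hn y hy u'
    (fun j hj => coeff_prod_X_sub_C_mem (K := K) y _ fun k hk => by
      rw [hπ]
      exact hmem k (by omega)) hij hkl hki hli (hyy i j h) (hyy k l h')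
  refine (ringKrullDim_le_of_isIntegral _ hv).trans ?_
  rw [ringKrullDim_mvPolynomial_field]
  simp only [Nat.card_eq_fintype_card, Fintype.card_option, Fintype.card_sum, Fintype.card_fin]
  exact_mod_cast (by omega : n - r - m + (r - 3) + 1 ≤ n - m - 2)

theorem dimension_rank_lt_le [IsAlgClosed K] (h2 : (2 : K) ≠ 0)
    (hr : 3 ≤ r) (hrn : r + m ≤ n) (hn : 3 < n)
    (a : Fin m → Fin (n - r) → K) (ha : LinearIndependent K a) (c : Fin m → K)
    (R : Fin m → MvPolynomial (Fin n) K)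
    (hR : ∀ j, R j = C (c j) + ∑ k, a j k • esymm (Fin n) K ((k : ℕ) + 1)) :
    dimension {y | y ∈ commonZeros R ∧ (jacobian R y).rank < m} ≤ (n - m - 2 : ℕ) := by
  classical
  have hinf : Infinite K := IsAlgClosed.instInfinite
  refine dimension_le_of_forall_prime _ _ fun Q hQ hWQ => ?_
  let T : Finset (Fin n × Fin n × Fin n × Fin n) := Finset.univ.filter fun x =>
    x.1 ≠ x.2.1 ∧ x.2.2.1 ≠ x.2.2.2 ∧ x.2.2.1 ≠ x.1 ∧ x.2.2.2 ≠ x.1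
  let I : Fin n × Fin n × Fin n × Fin n → Ideal (MvPolynomial (Fin n) K) := fun x =>
    Ideal.span {X x.1 - X x.2.1, X x.2.2.1 - X x.2.2.2}
  -- The locus is covered by finitely many collision subspaces, so the product of their ideals
  -- vanishes on it; a prime containing the product contains one factor.
  have hprod : T.prod I ≤ Q := by
    refine le_trans (b := vanishingIdeal K _) ?_ hWQ
    intro p hp y hy
    obtain ⟨i, j, k, l, hij, hkl, hki, hli, h, h'⟩ :=
      exists_collisions_of_rank_lt hr (by omega) a ha c R hR y hy.2
    have hmem : (i, j, k, l) ∈ T := by simp [T, hij, hkl, hki, hli]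
    have hle : T.prod I ≤ vanishingIdeal K {y} := by
      refine Ideal.prod_le_inf.trans ((Finset.inf_le hmem).trans ?_)
      rw [Ideal.span_le]
      rintro _ (rfl | rfl)
      · simp [h]
      · simp [h']
    exact hle hp y rfl
  obtain ⟨x, hxT, hx⟩ := hQ.prod_le.1 hprod
  simp only [T, Finset.mem_filter, Finset.mem_univ, true_and] at hxT
  obtain ⟨hij, hkl, hki, hli⟩ := hxT
  refine ringKrullDim_quotient_le_of_collisions h2 hr hrn hn a ha c R hR Q (fun j => hWQ ?_)
    hij hkl hki hli (hx (Ideal.subset_span (by simp))) (hx (Ideal.subset_span (by simp)))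
  intro y hy
  rw [aeval_eq_eval]
  exact hy.1 j

theorem symmetricSystem_apply {F K : Type*} [Field F] [Field K] [Algebra F K] {n m r : ℕ}
    (S : Fin m → MvPolynomial (Fin (n - r)) F) (hdeg : ∀ j, (S j).totalDegree = 1) (j : Fin m) :
    (symmetricSystem K S : Fin m → MvPolynomial (Fin n) K) j =
      C (algebraMap F K (coeff 0 (S j))) +
        ∑ k, algebraMap F K (linearPart (S j) k) • esymm (Fin n) K ((k : ℕ) + 1) := by
  rw [symmetricSystem, aeval_of_totalDegree_eq_one _ (hdeg j)]
  simp only [algebraMap_smul]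
  rfl

theorem dimension_empty {K : Type*} [Field K] [IsAlgClosed K] {n : ℕ} :
    dimension (∅ : Set (Fin n → K)) = ⊥ := by
  rw [dimension_eq_ringKrullDim, vanishingIdeal_empty]
  exact ringKrullDim_eq_bot_of_subsingleton

end RankDeficient

end SymmetricVariety

/-! ### The two codimension bounds -/

theorem theorem3p7 {F K : Type*} [Field F] [Finite F] [Field K] [Algebra F K] [IsAlgClosure F K]
    (hp : 2 < ringChar F)
    (m n r : ℕ) (hm : 0 < m) (hr : 3 ≤ r) (hrn : r + m ≤ n) (hq : n < Nat.card F)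
    (S : Fin m → MvPolynomial (Fin (n - r)) F)
    (hdeg : ∀ j, (S j).totalDegree = 1)
    (hS : LinearIndependent F (fun j => MvPolynomial.homogeneousComponent 1 (S j)))
    (R : Fin m → MvPolynomial (Fin n) K) (hR : R = SymmetricVariety.symmetricSystem K S)
    (V : Set (Fin n → K)) (hV : V = SymmetricVariety.commonZeros R) :
    SymmetricVariety.CodimensionAtLeast 2 V
        {y | y ∈ V ∧ (SymmetricVariety.jacobian R y).rank < m} ∧
      SymmetricVariety.CodimensionAtLeast 2 V (SymmetricVariety.singularLocus V) := by
  open SymmetricVariety in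
  subst hV
  have hclosed : IsAlgClosed K := IsAlgClosure.isAlgClosed F
  have h2 : (2 : K) ≠ 0 := by
    intro h
    have h2F : (2 : F) = 0 := by
      apply FaithfulSMul.algebraMap_injective F K
      rw [map_ofNat, h, map_zero]
    have := (ringChar.spec F 2).1 (by exact_mod_cast h2F)
    exact absurd (Nat.le_of_dvd two_pos this) (by omega)
  have ha : LinearIndependent K fun j => algebraMap F K ∘ linearPart (S j) :=
    linearIndependent_algebraMap_comp_iff.2 (linearIndependent_linearPart S hS)
  have hR' : ∀ j, R j = MvPolynomial.C (algebraMap F K (MvPolynomial.coeff 0 (S j))) +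
      ∑ k, (algebraMap F K ∘ linearPart (S j)) k • MvPolynomial.esymm (Fin n) K ((k : ℕ) + 1) :=
    fun j => by rw [hR, symmetricSystem_apply S hdeg]; rfl
  obtain ⟨u, hu⟩ := exists_isIntegral_parameters hrn _ ha _ R hR'
  have hτ : m + Nat.card (Fin (n - r - m) ⊕ Fin r) = n := by
    simp only [Nat.card_eq_fintype_card, Fintype.card_sum, Fintype.card_fin]
    omega
  have hdim : dimension {y | y ∈ commonZeros R ∧ (jacobian R y).rank < m} + 2 ≤
      dimension (commonZeros R) := by
    by_cases hne : (commonZeros R).Nonempty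
    · have h3 := dimension_rank_lt_le h2 hr hrn (by omega) _ ha _ R hR'
      refine le_trans ?_ (le_dimension_commonZeros hτ R u hu hne)
      refine le_trans (add_le_add_left h3 2) ?_
      exact_mod_cast (by omega : n - m - 2 + 2 ≤ Nat.card (Fin (n - r - m) ⊕ Fin r))
    -- For empty V both dimensions are ⊥, and ⊥ + 2 = ⊥.
    · rw [Set.not_nonempty_iff_eq_empty] at hne
      simp [hne, dimension_empty]
  refine ⟨⟨fun y hy => hy.1, hdim⟩, fun y hy => hy.1, ?_⟩
  exact le_trans (add_le_add_left (dimension_mono (singularLocus_subset hτ R u hu)) 2) hdim
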